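/- **Setting.** Let $p,q\in[1,\infty)$. For every $i\in\mathbb N$ fix positive integers $n_i,m_i$ and norms on $\mathbb R^{n_i},\mathbb R^{m_i}$. Let $X=\ell^p(\mathbb N,(n_i))$ be the space of sequences $x=(x_i)$, $x_i\in\mathbb R^{n_i}$, with $|x|_p=(\sum_i|x_i|^p)^{1/p}<\infty$, and $U=\ell^q(\mathbb N,(m_i))$ likewise. Let $\mathcal U$ be the set of strongly measurable, essentially bounded $u:[0,\infty)\to U$, with $|u|_{q,\infty}=\operatorname{ess\,sup}_{t\ge0}|u(t)|_q$. The subsystems are $\Sigma_i:\ \dot x_i=f_i(x_i,\bar x,u_i)$ with $f_i:\mathbb R^{n_i}\times X\times\mathbb R^{m_i}\to\mathbb R^{n_i}$ continuous, having unique local (Carathéodory) solutions for all initial states, all continuous $\bar x:[0,\infty)\to X$ and all locally essentially bounded $u_i$. Let $I_i$ be the set of $j$ such that $f_i$ is non-constant in the component $\bar x_j$; assume $i\notin I_i$. The network $\Sigma:\ \dot x=f(x,u)$ has $f(x,u)=(f_i(x_i,x,u_i))_i$; a solution on $[0,T)$, $T\in(0,\infty]$, is a continuous $\xi:[0,T)\to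 X$ with $f(\xi(t),u(t))\in X$ and $\xi(t)=x^0+\int_0^t f(\xi(s),u(s))\,ds$ (Bochner integral) for all $t\in[0,T)$. $\Sigma$ is *well-posed* if for all $x^0\in X$, $u\in\mathcal U$ a unique local solution exists; $\phi(\cdot,x^0,u)$ denotes the maximal one. $D^+$ and $D_+$ are the right upper and right lower Dini derivatives, and $|x|_{\mathcal A}$ is the distance from $x$ to a set $\mathcal A$. **Definitions.** Let $\mathcal A\subset X$ be nonempty and closed. A function $V:X\to[0,\infty)$, continuous on $X\setminus\mathcal A$, is an *eISS Lyapunov function* for $\Sigma$ w.r.t. $\mathcal A$ if there are $\underline\omega,\overline\omega,b,\kappa>0$ and $\gamma\in\mathcal K_\infty$ with $\underline\omega|x|_{\mathcal A}^b\le V(x)\le\overline\omega|x|_{\mathcal A}^b$ for all $x\in X$ and $D^+V_u(x):=D^+V(\phi(t,x,u))|_{t=0}\le-\kappa V(x)+\gamma(|u|_{q,\infty})$ for all $x\in X\setminus\mathcal A$, $u\in\mathcal U$. $\Sigma$ is *eISS w.r.t. $\mathcal A$* if all maximal solutions are defined on $[0,\infty)$ and there are $M,a>0$, $\gamma\in\mathcal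 K$ with $$|\phi(t,x^0,u)|_{\mathcal A}\le Me^{-at}|x^0|_{\mathcal A}+\gamma(|u|_{q,\infty})\qquad(\ast)$$ for all $t\ge0$, $x^0\in X$, $u\in\mathcal U$. **Theorem (small-gain theorem).** Suppose: (i) $\Sigma$ is well-posed. (ii) For each $i$ there are a nonempty closed $\mathcal A_i\subset\mathbb R^{n_i}$, a continuous $V_i:\mathbb R^{n_i}\to[0,\infty)$ and constants $\underline\alpha_i,\overline\alpha_i,\lambda_i,\gamma_{iu}>0$, $\gamma_{ij}>0$ ($j\in I_i$), such that $\underline\alpha_i|x_i|_{\mathcal A_i}^p\le V_i(x_i)\le\overline\alpha_i|x_i|_{\mathcal A_i}^p$ for all $x_i$, and such that for all $x_i\in\mathbb R^{n_i}\setminus\mathcal A_i$, continuous $\bar x:[0,\infty)\to X$ and $u_i\in L^\infty([0,\infty),\mathbb R^{m_i})$ the maximal solution $\phi_i$ of $\Sigma_i$ with $\phi_i(0)=x_i$ satisfies $$D^+(V_i\circ\phi_i)(t)\le-\lambda_iV_i(\phi_i(t))+\sum_{j\in I_i}\gamma_{ij}V_j(\bar x_j(t))+\gamma_{iu}|u_i(t)|^q$$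 for almost all $t$, and $D_+(V_i\circ\phi_i)(t)<\infty$ for all $t$, in its interval of existence. Moreover, there are constants $\underline\alpha,\overline\alpha,\underline\lambda,\overline\gamma_u>0$ with $\underline\alpha\le\underline\alpha_i\le\overline\alpha_i\le\overline\alpha$, $\underline\lambda\le\lambda_i$ and $\gamma_{iu}\le\overline\gamma_u$ for all $i$. (iii) With $\gamma_{ij}:=0$ for $j\notin I_i$, $\Gamma=(\gamma_{ij})$ is bounded on $\ell^1$, i.e. $\sup_j\sum_i\gamma_{ij}<\infty$. (iv) The spectral radius of $\Psi=\Lambda^{-1}\Gamma=(\gamma_{ij}/\lambda_i)$ on $\ell^1$, where $\Lambda=\operatorname{diag}(\lambda_i)$, satisfies $r(\Psi)<1$. (v) The set $\mathcal A:=X\cap(\mathcal A_1\times\mathcal A_2\times\cdots)$ is nonempty. Then there are $\mu=(\mu_i)$ and constants $\underline\mu,\overline\mu>0$ with $\underline\mu\le\mu_i\le\overline\mu$ for all $i$ such that $V(x)=\sum_i\mu_iV_i(x_i)$ converges on $X$ and is an eISS Lyapunov function for $\Sigma$ w.r.t. $\mathcal A$. In particular: (a) $V$ is continuous on $X\setminus\mathcal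 A$; (b) there is $\lambda_\infty>0$ with $D^+V_u(x^0)\le-\lambda_\infty V(x^0)+\overline\mu\,\overline\gamma_u|u|_{q,\infty}^q$ for all $x^0\in X\setminus\mathcal A$, $u\in\mathcal U$; (c) $\underline\mu\,\underline\alpha|x|_{\mathcal A}^p\le V(x)\le\overline\mu\,\overline\alpha|x|_{\mathcal A}^p$ for all $x\in X$. Moreover, there are $M,a>0$ and $\gamma\in\mathcal K$ such that $(\ast)$ holds for all $x^0\in X$, $u\in\mathcal U$ and all $t$ in the maximal interval of existence. Hence $\Sigma$ is eISS w.r.t. $\mathcal A$, provided that solutions on bounded intervals $[0,T)$ along which $|\cdot|_{\mathcal A}$ stays bounded can be continued beyond $T$ (which holds in particular if $\Sigma$ is forward complete; for bounded $\mathcal A$ it says that bounded solutions can be continued). -/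

import Mathlib

open Set Filter Topology MeasureTheory
open scoped ENNReal

noncomputable section

/-- The half-open time interval `[0, T)`, where `T` may be `∞`. -/
def timeInterval (T : EReal) : Set ℝ := {t | 0 ≤ t ∧ (t : EReal) < T}

/-- The right upper Dini derivative, with values in the extended reals. -/
def diniUpperRight (g : ℝ → ℝ) (t : ℝ) : EReal :=
  limsup (fun h : ℝ => (((g (t + h) - g t) / h : ℝ) : EReal)) (𝓝[>] 0)

/-- The right lower Dini derivative, with values in the extended reals. -/
def diniLowerRight (g : ℝ → ℝ) (t : ℝ) : EReal :=
  liminf (fun h : ℝ => (((g (t + h) - g t) / h : ℝ) : EReal)) (𝓝[>] 0)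

/-- Comparison functions of class `K`; only the values on `[0, ∞)` matter. -/
structure IsClassK (g : ℝ → ℝ) : Prop where
  continuousOn : ContinuousOn g (Ici 0)
  strictMonoOn : StrictMonoOn g (Ici 0)
  map_zero : g 0 = 0

/-- Comparison functions of class `K_∞`. -/
structure IsClassKInf (g : ℝ → ℝ) : Prop extends IsClassK g where
  tendsto_atTop : Tendsto g atTop atTop

/-- Strongly measurable and essentially bounded functions `[0, ∞) → U`
(the values at negative times are irrelevant). -/
def EssBounded {U : Type*} [NormedAddCommGroup U] (u : ℝ → U) : Prop :=
  MemLp u ⊤ (volume.restrict (Ici 0))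

/-- Locally essentially bounded functions `[0, ∞) → U`. -/
def LocEssBounded {U : Type*} [NormedAddCommGroup U] (u : ℝ → U) : Prop :=
  ∀ T : ℝ, MemLp u ⊤ (volume.restrict (Icc 0 T))

/-- The essential supremum of `‖u t‖` over `t ≥ 0`. -/
def essSupNorm {U : Type*} [NormedAddCommGroup U] (u : ℝ → U) : ℝ :=
  (eLpNorm u ⊤ (volume.restrict (Ici 0))).toReal

/-- `φ` is a (Carathéodory) solution on `[0, T)` of `φ' = g(φ, xbar, v)`, `φ(0) = x0`. -/
structure IsODESolution {E X F : Type*} [NormedAddCommGroup E] [NormedSpace ℝ E]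
    (g : E → X → F → E) (x0 : E) (xbar : ℝ → X) (v : ℝ → F) (T : EReal) (φ : ℝ → E) : Prop where
  pos : 0 < T
  continuousOn : ContinuousOn φ (timeInterval T)
  integrable : ∀ t ∈ timeInterval T,
    IntervalIntegrable (fun s => g (φ s) (xbar s) (v s)) volume 0 t
  eq_integral : ∀ t ∈ timeInterval T, φ t = x0 + ∫ s in (0 : ℝ)..t, g (φ s) (xbar s) (v s)

section Network

variable {E F : ℕ → Type*} [∀ i, NormedAddCommGroup (E i)] [∀ i, NormedSpace ℝ (E i)]
  [∀ i, NormedAddCommGroup (F i)] {p q : ℝ≥0∞} [Fact (1 ≤ p)] [Fact (1 ≤ q)]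

/-- The set `I_i` of those `j` for which `g(x_i, x̄, u_i)` is not constant with respect to the
component `x̄_j` of the internal input. -/
def inputNeighbors {i : ℕ} (g : E i → lp E p → F i → E i) : Set ℕ :=
  {j | ∃ (z : E i) (x y : lp E p) (v : F i), (∀ k, k ≠ j → x k = y k) ∧ g z x v ≠ g z y v}

variable (E F p) in
/-- A family of subsystems `x_i' = f_i(x_i, x̄, u_i)`, `i ∈ ℕ`, with `x_i ∈ E i`, internal input
`x̄ ∈ ℓ^p(ℕ, E)` and external input `u_i ∈ F i`, with continuous right-hand sides and unique local
solutions; `f_i` sees its own state only through the first argument. -/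
structure InfiniteNetwork where
  f : ∀ i, E i → lp E p → F i → E i
  continuous_f : ∀ i, Continuous fun z : E i × lp E p × F i => f i z.1 z.2.1 z.2.2
  self_notMem : ∀ i, i ∉ inputNeighbors (f i)
  exists_local : ∀ (i : ℕ) (x0 : E i) (xbar : ℝ → lp E p) (v : ℝ → F i),
    ContinuousOn xbar (Ici 0) → LocEssBounded v →
    ∃ T φ, IsODESolution (f i) x0 xbar v T φ
  unique_local : ∀ (i : ℕ) (x0 : E i) (xbar : ℝ → lp E p) (v : ℝ → F i),
    ContinuousOn xbar (Ici 0) → LocEssBounded v →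
    ∀ T₁ φ₁ T₂ φ₂, IsODESolution (f i) x0 xbar v T₁ φ₁ → IsODESolution (f i) x0 xbar v T₂ φ₂ →
      ∀ t ∈ timeInterval T₁ ∩ timeInterval T₂, φ₁ t = φ₂ t

namespace InfiniteNetwork

/-- `ξ` is a solution on `[0, T)` of the interconnection `x' = f(x, u)` in `X = ℓ^p(ℕ, E)`:
`f(ξ(t), u(t))`, the element `g t` below, lies in `X` for all `t`, and `ξ` solves the integral
equation with the Bochner integral in `X`. -/
structure IsSolution (S : InfiniteNetwork E F p) (x0 : lp E p) (u : ℝ → lp F q) (T : EReal)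
    (ξ : ℝ → lp E p) : Prop where
  pos : 0 < T
  continuousOn : ContinuousOn ξ (timeInterval T)
  eq_integral : ∃ g : ℝ → lp E p,
    (∀ t ∈ timeInterval T, ∀ i, g t i = S.f i (ξ t i) (ξ t) (u t i)) ∧
    ∀ t ∈ timeInterval T, IntervalIntegrable g volume 0 t ∧ ξ t = x0 + ∫ s in (0 : ℝ)..t, g s

variable (q) in
/-- Existence and uniqueness of local solutions for all initial states and all admissible inputs
with values in `ℓ^q(ℕ, F)`. -/
structure WellPosed (S : InfiniteNetwork E F p) : Prop where
  exists_local : ∀ (x0 : lp E p) (u : ℝ → lp F q), EssBounded u → ∃ T ξ, S.IsSolution x0 u T ξ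
  unique_local : ∀ (x0 : lp E p) (u : ℝ → lp F q), EssBounded u →
    ∀ T₁ ξ₁ T₂ ξ₂, S.IsSolution x0 u T₁ ξ₁ → S.IsSolution x0 u T₂ ξ₂ →
      ∀ t ∈ timeInterval T₁ ∩ timeInterval T₂, ξ₁ t = ξ₂ t

variable (q) in
/-- Every maximal solution is defined on `[0, ∞)`. -/
def ForwardComplete (S : InfiniteNetwork E F p) : Prop :=
  ∀ (x0 : lp E p) (u : ℝ → lp F q), EssBounded u → ∃ ξ, S.IsSolution x0 u ⊤ ξ

variable (q) in
/-- A solution on a bounded interval `[0, T)` whose distance to `A` stays bounded can be continued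
beyond `T`. (For a bounded set `A`: bounded solutions can be continued.) -/
def BoundedDistContinuation (S : InfiniteNetwork E F p) (A : Set (lp E p)) : Prop :=
  ∀ (x0 : lp E p) (u : ℝ → lp F q), EssBounded u → ∀ T ξ, T < ⊤ → S.IsSolution x0 u T ξ →
    (∃ C, ∀ t ∈ timeInterval T, Metric.infDist (ξ t) A ≤ C) →
    ∃ T' ξ', T < T' ∧ S.IsSolution x0 u T' ξ'

/-- The exponential estimate with constants `M`, `a` and gain `g`, for all solutions and as long as
they exist. -/
def HasExpEstimate (S : InfiniteNetwork E F p) (q : ℝ≥0∞) [Fact (1 ≤ q)] (A : Set (lp E p))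
    (M a : ℝ) (g : ℝ → ℝ) : Prop :=
  ∀ (x0 : lp E p) (u : ℝ → lp F q), EssBounded u → ∀ T ξ, S.IsSolution x0 u T ξ →
    ∀ t ∈ timeInterval T,
      Metric.infDist (ξ t) A ≤ M * Real.exp (-a * t) * Metric.infDist x0 A + g (essSupNorm u)

variable (q) in
/-- Exponential input-to-state stability with respect to a nonempty closed set. -/
structure IsEISS (S : InfiniteNetwork E F p) (A : Set (lp E p)) : Prop where
  nonempty : A.Nonempty
  isClosed : IsClosed A
  forwardComplete : S.ForwardComplete q
  estimate : ∃ (M a : ℝ) (g : ℝ → ℝ), 0 < M ∧ 0 < a ∧ IsClassK g ∧ S.HasExpEstimate q A M a g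

variable (q) in
/-- For all `x ∉ A` and all admissible `u`, the orbital derivative `D⁺W_u(x)`, that is, the right
upper Dini derivative at `t = 0` of `W` along the solution from `x` under `u`, is at most
`-κ W(x) + g(‖u‖)`. -/
def OrbitalDecay (S : InfiniteNetwork E F p) (A : Set (lp E p)) (W : lp E p → ℝ) (κ : ℝ)
    (g : ℝ → ℝ) : Prop :=
  ∀ x ∉ A, ∀ u : ℝ → lp F q, EssBounded u → ∀ T ξ, S.IsSolution x u T ξ →
    diniUpperRight (fun t => W (ξ t)) 0 ≤ ((-κ * W x + g (essSupNorm u) : ℝ) : EReal)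

variable (q) in
/-- eISS Lyapunov functions for the interconnection with respect to a nonempty closed set. -/
structure IsEISSLyapunov (S : InfiniteNetwork E F p) (A : Set (lp E p)) (W : lp E p → ℝ) :
    Prop where
  nonempty : A.Nonempty
  isClosed : IsClosed A
  nonneg : ∀ x, 0 ≤ W x
  continuousOn : ContinuousOn W Aᶜ
  exists_bounds : ∃ (ω₁ ω₂ b κ : ℝ) (g : ℝ → ℝ), 0 < ω₁ ∧ 0 < ω₂ ∧ 0 < b ∧ 0 < κ ∧ IsClassKInf g ∧
    (∀ x, ω₁ * Metric.infDist x A ^ b ≤ W x ∧ W x ≤ ω₂ * Metric.infDist x A ^ b) ∧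
    S.OrbitalDecay q A W κ g

/-- Continuous eISS Lyapunov functions `V i` for the subsystems with respect to the nonempty closed
sets `A i`, with coercivity constants `αl i`, `αu i`, decay rates `lam i`, internal gains `γ i j`
(zero unless `j ∈ I_i`) and external gains `γu i`. The sum of the internal gain terms may be
infinite, and is therefore taken in `[0, ∞]`. -/
structure SubsystemLyapunov (S : InfiniteNetwork E F p) (q : ℝ≥0∞) (A : ∀ i, Set (E i))
    (V : ∀ i, E i → ℝ) (αl αu lam : ℕ → ℝ) (γ : ℕ → ℕ → ℝ) (γu : ℕ → ℝ) : Prop where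
  nonempty : ∀ i, (A i).Nonempty
  isClosed : ∀ i, IsClosed (A i)
  continuous : ∀ i, Continuous (V i)
  nonneg : ∀ i x, 0 ≤ V i x
  αl_pos : ∀ i, 0 < αl i
  αu_pos : ∀ i, 0 < αu i
  lam_pos : ∀ i, 0 < lam i
  γu_pos : ∀ i, 0 < γu i
  γ_pos : ∀ i, ∀ j ∈ inputNeighbors (S.f i), 0 < γ i j
  γ_zero : ∀ i, ∀ j ∉ inputNeighbors (S.f i), γ i j = 0
  coercive : ∀ i x, αl i * Metric.infDist x (A i) ^ p.toReal ≤ V i x ∧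
    V i x ≤ αu i * Metric.infDist x (A i) ^ p.toReal
  dissipation : ∀ i, ∀ x ∉ A i, ∀ (xbar : ℝ → lp E p) (v : ℝ → F i),
    ContinuousOn xbar (Ici 0) → EssBounded v →
    ∀ T φ, IsODESolution (S.f i) x xbar v T φ →
      ∀ᵐ t : ℝ, t ∈ timeInterval T →
        diniUpperRight (fun s => V i (φ s)) t ≤
          ((-lam i * V i (φ t) + γu i * ‖v t‖ ^ q.toReal : ℝ) : EReal) +
            ((∑' j, ENNReal.ofReal (γ i j * V j (xbar t j)) : ℝ≥0∞) : EReal)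
  diniLower_lt_top : ∀ i, ∀ x ∉ A i, ∀ (xbar : ℝ → lp E p) (v : ℝ → F i),
    ContinuousOn xbar (Ici 0) → EssBounded v →
    ∀ T φ, IsODESolution (S.f i) x xbar v T φ →
      ∀ t ∈ timeInterval T, diniLowerRight (fun s => V i (φ s)) t < ⊤

end InfiniteNetwork

variable (p) in
/-- `X ∩ (A_1 × A_2 × …)` for `X = ℓ^p(ℕ, E)`. -/
def lpProductSet (A : ∀ i, Set (E i)) : Set (lp E p) := {x | ∀ i, x i ∈ A i}

end Network

/-- `sup_j ∑_i |M i j| < ∞`, i.e. the matrix `M` is a bounded operator on `ℓ¹`. -/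
def BoundedColumns (M : ℕ → ℕ → ℝ) : Prop :=
  ∃ C : ℝ, ∀ j, Summable (fun i => |M i j|) ∧ ∑' i, |M i j| ≤ C

/-- Complex `ℓ¹`. -/
abbrev EllOne : Type := lp (fun _ : ℕ => ℂ) 1

theorem EllOne.summable_norm (x : EllOne) : Summable fun j => ‖x j‖ := by
  have h := (lp.memℓp x).summable (by norm_num)
  simpa only [ENNReal.toReal_one, Real.rpow_one] using h

theorem EllOne.norm_eq (x : EllOne) : ‖x‖ = ∑' j, ‖x j‖ := by
  have h := lp.norm_eq_tsum_rpow (p := 1) (by norm_num) x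
  simpa only [ENNReal.toReal_one, Real.rpow_one, div_one] using h

theorem summable_matrix_mul {M : ℕ → ℕ → ℝ} {C : ℝ}
    (hC : ∀ j, Summable (fun i => |M i j|) ∧ ∑' i, |M i j| ≤ C) (x : EllOne) :
    Summable fun ji : ℕ × ℕ => |M ji.2 ji.1| * ‖x ji.1‖ := by
  rw [summable_prod_of_nonneg (fun _ => by positivity)]
  refine ⟨fun j => Summable.mul_right ‖x j‖ (hC j).1, ?_⟩
  simp only [tsum_mul_right]
  exact Summable.of_nonneg_of_le (fun j => mul_nonneg (tsum_nonneg fun _ => abs_nonneg _)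
    (norm_nonneg _)) (fun j => mul_le_mul_of_nonneg_right (hC j).2 (norm_nonneg _))
    (x.summable_norm.mul_left C)

theorem summable_matrix_row {M : ℕ → ℕ → ℝ} (hM : BoundedColumns M) (x : EllOne) (i : ℕ) :
    Summable fun j => (M i j : ℂ) * x j := by
  obtain ⟨C, hC⟩ := hM
  refine Summable.of_norm ?_
  simpa using (summable_matrix_mul hC x).prod_symm.prod_factor i

theorem summable_matrix_apply {M : ℕ → ℕ → ℝ} {C : ℝ}
    (hC : ∀ j, Summable (fun i => |M i j|) ∧ ∑' i, |M i j| ≤ C) (x : EllOne) :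
    (Summable fun i => ‖∑' j, (M i j : ℂ) * x j‖) ∧
      ∑' i, ‖∑' j, (M i j : ℂ) * x j‖ ≤ C * ‖x‖ := by
  have hs := (summable_matrix_mul hC x).prod_symm
  have hle : ∀ i, ‖∑' j, (M i j : ℂ) * x j‖ ≤ ∑' j, |M i j| * ‖x j‖ := fun i => by
    have h : Summable fun j => ‖(M i j : ℂ) * x j‖ := by simpa using hs.prod_factor i
    simpa using norm_tsum_le_tsum_norm h
  have hsum : Summable fun i => ∑' j, |M i j| * ‖x j‖ := by simpa using hs.prod
  have hs1 := Summable.of_nonneg_of_le (fun i => norm_nonneg _) hle hsum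
  refine ⟨hs1, (hs1.tsum_le_tsum hle hsum).trans ?_⟩
  have hcomm : ∑' i, ∑' j, |M i j| * ‖x j‖ = ∑' j, ∑' i, |M i j| * ‖x j‖ :=
    Summable.tsum_comm (f := fun j i => |M i j| * ‖x j‖) (summable_matrix_mul hC x)
  rw [hcomm, x.norm_eq, ← tsum_mul_left]
  have h2 : Summable fun j => ∑' i, |M i j| * ‖x j‖ := by
    simpa using (summable_matrix_mul hC x).prod
  refine h2.tsum_le_tsum (fun j => ?_) (x.summable_norm.mul_left C)
  rw [tsum_mul_right]
  exact mul_le_mul_of_nonneg_right (hC j).2 (norm_nonneg _)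

/-- The bounded operator on complex `ℓ¹` given by a real infinite matrix with bounded columns,
`(M x)_i = ∑_j M i j x_j`. -/
def matrixOperator (M : ℕ → ℕ → ℝ) (hM : BoundedColumns M) : EllOne →L[ℂ] EllOne :=
  LinearMap.mkContinuousOfExistsBound
    { toFun := fun x => ⟨fun i => ∑' j, (M i j : ℂ) * x j, by
        obtain ⟨C, hC⟩ := hM
        refine memℓp_gen ?_
        simpa using (summable_matrix_apply hC x).1⟩
      map_add' := fun x y => by
        ext i
        have h := (summable_matrix_row hM x i).tsum_add (summable_matrix_row hM y i)
        simp only [← mul_add] at h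
        exact h
      map_smul' := fun c x => by
        ext i
        simp [← tsum_mul_left, mul_left_comm] }
    (by
      obtain ⟨C, hC⟩ := hM
      refine ⟨C, fun x => ?_⟩
      rw [EllOne.norm_eq]
      exact (summable_matrix_apply hC x).2)

theorem matrixOperator_apply (M : ℕ → ℕ → ℝ) (hM : BoundedColumns M) (x : EllOne) (i : ℕ) :
    matrixOperator M hM x i = ∑' j, (M i j : ℂ) * x j := rfl

theorem BoundedColumns.div_rows {γ : ℕ → ℕ → ℝ} (hγ : BoundedColumns γ) {lam : ℕ → ℝ} {c : ℝ}
    (hc : 0 < c) (hlam : ∀ i, c ≤ lam i) : BoundedColumns fun i j => γ i j / lam i := by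
  obtain ⟨C, hC⟩ := hγ
  refine ⟨C / c, fun j => ?_⟩
  have hle : ∀ i, |γ i j / lam i| ≤ |γ i j| / c := fun i => by
    rw [abs_div, abs_of_pos (hc.trans_le (hlam i))]
    exact div_le_div_of_nonneg_left (abs_nonneg _) hc (hlam i)
  have hs := Summable.of_nonneg_of_le (fun i => abs_nonneg _) hle ((hC j).1.div_const c)
  refine ⟨hs, (hs.tsum_le_tsum hle ((hC j).1.div_const c)).trans ?_⟩
  rw [tsum_div_const]
  exact div_le_div_of_nonneg_right (hC j).2 hc.le

/-- The gain operator `Ψ = Λ⁻¹ Γ` on `ℓ¹`, for decay rates bounded below by `c > 0`. -/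
def gainOperator (lam : ℕ → ℝ) (γ : ℕ → ℕ → ℝ) {c : ℝ} (hc : 0 < c) (hlam : ∀ i, c ≤ lam i)
    (hγ : BoundedColumns γ) : EllOne →L[ℂ] EllOne :=
  matrixOperator (fun i j => γ i j / lam i) (hγ.div_rows hc hlam)

end

/-!
The weights come from a Neumann series. For `Φ = Γ Λ⁻¹` one has `Φ ^ (k + 1) = Γ Ψ ^ k Λ⁻¹`, and
`‖Ψ ^ k‖` is summable by Gelfand's formula, since `r(Ψ) < 1`. So the column sums `w` of `∑ₖ Γ Ψ ^ k`
are bounded, and the column sums `μ = 1 + Λ⁻¹ w` of `∑ₖ Φ ^ k` satisfy `Γᵀ μ = w = Λ (μ - 1)`, see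
`exists_weights`. Hence `μ` lies between `1` and a constant, and formally the derivative of
`∑ μ i * V i` is at most `-∑ lam i * V i` plus the contribution of the external input.

Making this rigorous takes two steps. First, the dissipation inequality of one subsystem holds only
almost everywhere and for components that start outside `A i`. It is integrated by a comparison
principle for Dini derivatives (`sub_le_integral_of_diniUpperRight_le`), with restarts at times just
after the component first leaves `A i`
(`InfiniteNetwork.SubsystemLyapunov.integrated_dissipation`). Second, the integrated inequalities
are summed with the weights `μ i`. Since the rates `lam i` may be unbounded, the sums are
taken in `[0, ∞]`, and only the finite sum `∑ w j * ∫ V j` is subtracted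
(`InfiniteNetwork.SubsystemLyapunov.weightedSum_integral_le`). The outcome is an inequality
`W(ξ t) + κ ∫ W(ξ) ≤ W(ξ s) + C (t - s)` for the weighted sum `W`, between arbitrary times of any
solution.

`W` is continuous on all of `ℓ^p` (`continuous_weightedSum`), because it is dominated termwise by a
multiple of `∑ dist(x i, A i) ^ p = dist(x, A) ^ p` (`hasSum_infDist_rpow`); this also gives its
coercivity. Continuity turns the integral inequality into the bound on the orbital derivative, and
Grönwall's inequality turns it into the exponential estimate. Finally, solutions glue to a maximal
one, which by the estimate stays within bounded distance of `A` and so is global under the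
continuation hypothesis.
-/

section

/-! ### A comparison principle for Dini derivatives -/

/-- If the lower right slope of `g` at every `t ∈ [a, b)` is at most `φ t`, with `φ` integrable,
then `g b - g a ≤ ∫ φ`. As in the fundamental theorem of calculus for one-sided derivatives, `φ` is
replaced by a lower semicontinuous majorant (Vitali–Carathéodory), whose integral grows at least as
fast as `g` on arbitrarily short intervals to the right of each point. -/
theorem sub_le_integral_of_frequently_slope_le {g φ : ℝ → ℝ} {a b : ℝ} (hab : a ≤ b)
    (hcont : ContinuousOn g (Icc a b)) (φint : IntegrableOn φ (Icc a b))
    (hφ : ∀ t ∈ Ico a b, ∀ y, φ t < y → ∃ᶠ u in 𝓝[>] t, g u - g t ≤ (u - t) * y) :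
    g b - g a ≤ ∫ t in a..b, φ t := by
  refine le_of_forall_pos_le_add fun ε εpos => ?_
  rcases exists_lt_lowerSemicontinuous_integral_lt φ φint εpos with
    ⟨G, f_lt_G, Gcont, Gint, Glt_top, hG⟩
  set s := {t | g t - g a ≤ ∫ u in a..t, (G u).toReal} ∩ Icc a b
  -- Real induction: `s` is closed, and to the right of each of its points, except `b`, there are
  -- others arbitrarily close.
  have s_closed : IsClosed s := by
    have : ContinuousOn (fun t => (g t - g a, ∫ u in a..t, (G u).toReal)) (Icc a b) := by
      rw [← uIcc_of_le hab] at Gint hcont ⊢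
      exact (hcont.sub continuousOn_const).prodMk
        (intervalIntegral.continuousOn_primitive_interval Gint)
    simp only [s, inter_comm]
    exact this.preimage_isClosed_of_isClosed isClosed_Icc OrderClosedTopology.isClosed_le'
  have main : Icc a b ⊆ {t | g t - g a ≤ ∫ u in a..t, (G u).toReal} := by
    refine s_closed.Icc_subset_of_forall_exists_gt
      (by simp only [intervalIntegral.integral_same, mem_ofPred_eq, sub_self, le_rfl])
      fun t ht v t_lt_v => ?_
    obtain ⟨y, f_lt_y, y_lt_G⟩ : ∃ y : ℝ, (φ t : EReal) < y ∧ (y : EReal) < G t :=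
      EReal.lt_iff_exists_real_btwn.1 (f_lt_G t)
    -- Near `t` the integrand exceeds `y`, by lower semicontinuity.
    have I1 : ∀ᶠ u in 𝓝[>] t, (u - t) * y ≤ ∫ w in t..u, (G w).toReal := by
      have B : ∀ᶠ u in 𝓝 t, (y : EReal) < G u := Gcont.lowerSemicontinuousAt _ _ y_lt_G
      rcases mem_nhds_iff_exists_Ioo_subset.1 B with ⟨m, M, ⟨hm, hM⟩, H⟩
      have : Ioo t (min M b) ∈ 𝓝[>] t := Ioo_mem_nhdsGT (lt_min hM ht.right.right)
      filter_upwards [this] with u hu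
      have I : Icc t u ⊆ Icc a b := Icc_subset_Icc ht.2.1 (hu.2.le.trans (min_le_right _ _))
      calc
        (u - t) * y = ∫ _ in Icc t u, y := by
          simp only [MeasureTheory.integral_const, MeasurableSet.univ, measureReal_restrict_apply,
            univ_inter, hu.left.le, Real.volume_real_Icc_of_le, smul_eq_mul]
        _ ≤ ∫ w in t..u, (G w).toReal := by
          rw [intervalIntegral.integral_of_le hu.1.le, ← integral_Icc_eq_integral_Ioc]
          apply setIntegral_mono_ae_restrict
          · simp
          · exact IntegrableOn.mono_set Gint I
          · have C1 : ∀ᵐ x : ℝ ∂volume.restrict (Icc t u), G x < ⊤ :=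
              ae_mono (Measure.restrict_mono I le_rfl) Glt_top
            have C2 : ∀ᵐ x : ℝ ∂volume.restrict (Icc t u), x ∈ Icc t u :=
              ae_restrict_mem measurableSet_Icc
            filter_upwards [C1, C2] with x Gx hx
            apply EReal.coe_le_coe_iff.1
            have : x ∈ Ioo m M := by
              simp only [hm.trans_le hx.left,
                (hx.right.trans_lt hu.right).trans_le (min_le_left M b), mem_Ioo, and_self_iff]
            refine (H this).out.le.trans_eq ?_
            exact (EReal.coe_toReal Gx.ne (f_lt_G x).ne_bot).symm
    have I2 : ∃ᶠ u in 𝓝[>] t, g u - g t ≤ (u - t) * y :=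
      hφ t ht.2 y (EReal.coe_lt_coe_iff.1 f_lt_y)
    have I4 : ∀ᶠ u in 𝓝[>] t, u ∈ Ioc t (min v b) := Ioc_mem_nhdsGT <| lt_min t_lt_v ht.2.2
    rcases (I2.and_eventually (I1.and I4)).exists with ⟨x, hx2, hx1, h'x⟩
    have hx := hx2.trans hx1
    refine ⟨x, ?_, Ioc_subset_Ioc le_rfl (min_le_left _ _) h'x⟩
    calc
      g x - g a = g t - g a + (g x - g t) := by abel
      _ ≤ (∫ w in a..t, (G w).toReal) + ∫ w in t..x, (G w).toReal := add_le_add ht.1 hx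
      _ = ∫ w in a..x, (G w).toReal := by
        apply intervalIntegral.integral_add_adjacent_intervals
        · rw [intervalIntegrable_iff_integrableOn_Ioc_of_le ht.2.1]
          exact IntegrableOn.mono_set Gint
            (Ioc_subset_Icc_self.trans (Icc_subset_Icc le_rfl ht.2.2.le))
        · rw [intervalIntegrable_iff_integrableOn_Ioc_of_le h'x.1.le]
          exact IntegrableOn.mono_set Gint
            (Ioc_subset_Icc_self.trans
              (Icc_subset_Icc ht.2.1 (h'x.2.trans (min_le_right _ _))))
  calc
    g b - g a ≤ ∫ y in a..b, (G y).toReal := main (right_mem_Icc.2 hab)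
    _ ≤ (∫ y in a..b, φ y) + ε := by
      simpa only [intervalIntegral.integral_of_le hab, ← integral_Icc_eq_integral_Ioc] using hG.le

theorem frequently_sub_le_of_diniLowerRight_lt {g : ℝ → ℝ} {t y : ℝ}
    (h : diniLowerRight g t < y) : ∃ᶠ u in 𝓝[>] t, g u - g t ≤ (u - t) * y := by
  have h1 := frequently_lt_of_liminf_lt (by isBoundedDefault) h
  have h2 : ∃ᶠ k in 𝓝[>] (0 : ℝ), g (t + k) - g t ≤ k * y := by
    refine (h1.and_eventually self_mem_nhdsWithin).mono ?_
    rintro k ⟨hk, hk0⟩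
    rw [EReal.coe_lt_coe_iff, div_lt_iff₀ hk0] at hk
    linarith
  have h3 : Tendsto (fun k => t + k) (𝓝[>] (0 : ℝ)) (𝓝[>] t) := by
    refine tendsto_nhdsWithin_of_tendsto_nhds_of_eventually_within _ ?_ ?_
    · have : Tendsto (fun k : ℝ => t + k) (𝓝 0) (𝓝 (t + 0)) :=
        (continuous_const.add continuous_id).tendsto 0
      rw [add_zero] at this
      exact this.mono_left nhdsWithin_le_nhds
    · filter_upwards [self_mem_nhdsWithin] with k hk
      simpa using hk
  refine h3.frequently (h2.mono fun k hk => ?_)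
  simpa using hk

theorem diniLowerRight_le_diniUpperRight (g : ℝ → ℝ) (t : ℝ) :
    diniLowerRight g t ≤ diniUpperRight g t :=
  liminf_le_limsup

/-- A continuous function whose upper Dini derivative is at most an integrable `r` almost everywhere
grows by at most `∫ r`, provided that its lower Dini derivative is nowhere `+∞`. -/
theorem sub_le_integral_of_diniUpperRight_le {g r : ℝ → ℝ} {a b : ℝ} (hab : a ≤ b)
    (hcont : ContinuousOn g (Icc a b)) (rint : IntegrableOn r (Icc a b))
    (hlow : ∀ t ∈ Ioo a b, diniLowerRight g t < ⊤)
    (hup : ∀ᵐ t : ℝ, t ∈ Ioo a b → diniUpperRight g t ≤ (r t : EReal)) :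
    g b - g a ≤ ∫ t in a..b, r t := by
  classical
  -- On the exceptional null set `r` may be replaced by the finite lower Dini derivative.
  let φ : ℝ → ℝ := fun t => if diniLowerRight g t ≤ r t then r t else (diniLowerRight g t).toReal
  have hφ : ∀ t ∈ Ioo a b, diniLowerRight g t ≤ φ t := by
    intro t ht
    by_cases h : diniLowerRight g t ≤ r t
    · simp [φ, h]
    · simp only [φ, h, if_false]
      rw [EReal.coe_toReal (hlow t ht).ne]
      rintro hb
      exact h (by simp [hb])
  have hae : r =ᵐ[volume.restrict (Icc a b)] φ := by
    rw [← Measure.restrict_congr_set (Ioo_ae_eq_Icc (μ := volume) (a := a) (b := b))]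
    filter_upwards [ae_restrict_of_ae hup, ae_restrict_mem measurableSet_Ioo] with t h1 h2
    simp [φ, (diniLowerRight_le_diniUpperRight g t).trans (h1 h2)]
  have φint : IntegrableOn φ (Icc a b) := rint.congr hae
  have hint : ∫ t in a..b, r t = ∫ t in a..b, φ t := by
    simp only [intervalIntegral.integral_of_le hab, ← integral_Icc_eq_integral_Ioc]
    exact integral_congr_ae hae
  rw [hint]
  rcases hab.eq_or_lt with rfl | hlt
  · simp
  have key : ∀ c ∈ Ioo a b, g b - g c ≤ ∫ t in c..b, φ t := fun c hc =>
    sub_le_integral_of_frequently_slope_le hc.2.le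
      (hcont.mono (Icc_subset_Icc hc.1.le le_rfl))
      (φint.mono_set (Icc_subset_Icc hc.1.le le_rfl)) fun t ht y hy =>
      frequently_sub_le_of_diniLowerRight_lt
        ((hφ t ⟨hc.1.trans_le ht.1, ht.2⟩).trans_lt (EReal.coe_lt_coe_iff.2 hy))
  have hne : (𝓝[Ioo a b] a).NeBot := by
    rw [nhdsWithin_Ioo_eq_nhdsGT hlt]; infer_instance
  refine le_of_tendsto_of_tendsto (b := 𝓝[Ioo a b] a) ?_ ?_
    (eventually_of_mem self_mem_nhdsWithin key)
  · exact tendsto_const_nhds.sub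
      (((hcont a (left_mem_Icc.2 hab)).mono Ioo_subset_Icc_self).tendsto)
  · have := intervalIntegral.continuousOn_primitive_interval_left
      (by rwa [uIcc_of_le hab] : IntegrableOn φ (uIcc a b))
    rw [uIcc_of_le hab] at this
    exact ((this a (left_mem_Icc.2 hab)).mono Ioo_subset_Icc_self).tendsto

end

section

theorem EReal.add_coe_ennreal_of_ne_top (x : ℝ) {y : ℝ≥0∞} (hy : y ≠ ⊤) :
    (x : EReal) + (y : EReal) = ((x + y.toReal : ℝ) : EReal) := by
  lift y to NNReal using hy
  rw [EReal.coe_add]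
  rfl

/-- The integrated form of a dissipation inequality `D⁺f ≤ -L f + P + Q`, where `Q` may take the
value `∞`. Stating it in `[0, ∞]`, with `L ∫ f` on the left, avoids all integrability side
conditions. -/
theorem ofReal_add_lintegral_le_of_diniUpperRight_le {f P : ℝ → ℝ} {Q : ℝ → ℝ≥0∞} {a b L : ℝ}
    (hab : a ≤ b) (hL : 0 ≤ L) (hf : ContinuousOn f (Icc a b)) (hf0 : ∀ t, 0 ≤ f t)
    (hP0 : ∀ t, 0 ≤ P t) (hP : AEMeasurable P (volume.restrict (Icc a b)))
    (hQ : AEMeasurable Q (volume.restrict (Icc a b)))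
    (hlow : ∀ t ∈ Ioo a b, diniLowerRight f t < ⊤)
    (hup : ∀ᵐ t : ℝ, t ∈ Ioo a b →
      diniUpperRight f t ≤ ((-L * f t + P t : ℝ) : EReal) + (Q t : EReal)) :
    ENNReal.ofReal (f b) + ENNReal.ofReal L * ∫⁻ t in Icc a b, ENNReal.ofReal (f t) ≤
      ENNReal.ofReal (f a) + ∫⁻ t in Icc a b, (ENNReal.ofReal (P t) + Q t) := by
  set R : ℝ → ℝ≥0∞ := fun t => ENNReal.ofReal (P t) + Q t with hR
  have hRm : AEMeasurable R (volume.restrict (Icc a b)) := hP.ennreal_ofReal.add hQ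
  by_cases hfin : ∫⁻ t in Icc a b, R t = ⊤
  · simp [hfin]
  have hRfin : ∀ᵐ t ∂(volume.restrict (Icc a b)), R t < ⊤ := ae_lt_top' hRm hfin
  have hRint : IntegrableOn (fun t => (R t).toReal) (Icc a b) :=
    integrable_toReal_of_lintegral_ne_top hRm hfin
  have hfint : IntegrableOn f (Icc a b) := hf.integrableOn_Icc
  have hmain := sub_le_integral_of_diniUpperRight_le (g := f)
    (r := fun t => -L * f t + (R t).toReal) hab hf ((hfint.const_mul (-L)).add hRint) hlow (by
      have h1 := (ae_restrict_iff' measurableSet_Icc).1 hRfin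
      filter_upwards [hup, h1] with t h2 h3 ht
      have h4 := h3 (Ioo_subset_Icc_self ht)
      have hQt : Q t ≠ ⊤ := (lt_of_le_of_lt le_add_self h4).ne
      refine (h2 ht).trans_eq ?_
      rw [EReal.add_coe_ennreal_of_ne_top _ hQt, hR]
      simp only
      rw [ENNReal.toReal_add ENNReal.ofReal_ne_top hQt, ENNReal.toReal_ofReal (hP0 t), add_assoc])
  rw [intervalIntegral.integral_of_le hab, ← integral_Icc_eq_integral_Ioc,
    integral_add (hfint.const_mul (-L)) hRint, integral_const_mul,
    integral_toReal hRm hRfin] at hmain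
  have hI := ofReal_integral_eq_lintegral_ofReal hfint (Eventually.of_forall hf0)
  rw [← hI, ← ENNReal.ofReal_mul hL, ← ENNReal.ofReal_toReal hfin,
    ← ENNReal.ofReal_add (hf0 b) (mul_nonneg hL (integral_nonneg hf0)),
    ← ENNReal.ofReal_add (hf0 a) ENNReal.toReal_nonneg]
  exact ENNReal.ofReal_le_ofReal (by linarith)

theorem diniUpperRight_comp_const_add (g : ℝ → ℝ) (s t : ℝ) :
    diniUpperRight (fun r => g (s + r)) t = diniUpperRight g (s + t) := by
  simp only [diniUpperRight, add_assoc]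

theorem diniLowerRight_comp_const_add (g : ℝ → ℝ) (s t : ℝ) :
    diniLowerRight (fun r => g (s + r)) t = diniLowerRight g (s + t) := by
  simp only [diniLowerRight, add_assoc]

/-! ### Subsystems along a solution of the network -/

theorem mem_timeInterval_coe {a t : ℝ} : t ∈ timeInterval (a : EReal) ↔ t ∈ Ico 0 a := by
  simp [timeInterval]

theorem mem_timeInterval_of_le {T : EReal} {s t : ℝ} (hs : 0 ≤ s) (hst : s ≤ t)
    (ht : t ∈ timeInterval T) : s ∈ timeInterval T :=
  ⟨hs, (EReal.coe_le_coe_iff.2 hst).trans_lt ht.2⟩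

theorem Icc_subset_timeInterval {T : EReal} {s t : ℝ} (hs : 0 ≤ s) (ht : t ∈ timeInterval T) :
    Icc s t ⊆ timeInterval T := fun _ hr => mem_timeInterval_of_le (hs.trans hr.1) hr.2 ht

theorem EssBounded.comp_const_add {U : Type*} [NormedAddCommGroup U] {u : ℝ → U}
    (hu : EssBounded u) {s : ℝ} (hs : 0 ≤ s) : EssBounded fun r => u (s + r) := by
  have h1 : MeasurePreserving (fun r : ℝ => s + r) (volume.restrict ((fun r => s + r) ⁻¹' Ici s))
      (volume.restrict (Ici s)) :=
    (measurePreserving_add_left volume s).restrict_preimage measurableSet_Ici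
  have h2 : (fun r : ℝ => s + r) ⁻¹' Ici s = Ici 0 := by ext r; simp
  rw [h2] at h1
  exact MemLp.comp_measurePreserving
    (hu.mono_measure (Measure.restrict_mono (Ici_subset_Ici.2 hs) le_rfl)) h1

variable {E F : ℕ → Type*} [∀ i, NormedAddCommGroup (E i)] [∀ i, NormedSpace ℝ (E i)]
  [∀ i, NormedAddCommGroup (F i)] {p q : ℝ≥0∞} [Fact (1 ≤ p)]

theorem EssBounded.apply [Fact (1 ≤ q)] [∀ i, NormedSpace ℝ (F i)] {u : ℝ → lp F q}
    (hu : EssBounded u) (i : ℕ) : EssBounded fun t => u t i :=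
  (lp.evalCLM ℝ F q i).comp_memLp' hu

namespace InfiniteNetwork

variable {S : InfiniteNetwork E F p} {x0 : lp E p} {u : ℝ → lp F q} {T : EReal} {ξ : ℝ → lp E p}

theorem IsSolution.apply_zero (h : S.IsSolution x0 u T ξ) : ξ 0 = x0 := by
  obtain ⟨g, -, hg⟩ := h.eq_integral
  simpa using (hg 0 ⟨le_rfl, by simpa using h.pos⟩).2

/-- Restarted at a time `s`, the `i`-th component of a solution of the network is a solution of the
`i`-th subsystem. The solution of the network, which serves as the internal input, is frozen at time
`t`, because internal inputs have to be continuous on all of `[0, ∞)`. -/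
theorem IsSolution.isODESolution_apply [∀ i, CompleteSpace (E i)] (h : S.IsSolution x0 u T ξ)
    (i : ℕ) {s t : ℝ} (hs : 0 ≤ s) (hst : s < t) (ht : t ∈ timeInterval T) :
    IsODESolution (S.f i) (ξ s i) (fun r => ξ (min (s + r) t)) (fun r => u (s + r) i)
      ((t - s : ℝ) : EReal) (fun r => ξ (s + r) i) := by
  obtain ⟨g, hg1, hg2⟩ := h.eq_integral
  have hsub := Icc_subset_timeInterval hs ht
  have hmem : ∀ r ∈ timeInterval ((t - s : ℝ) : EReal), s + r ∈ Icc s t := fun r hr => by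
    rw [mem_timeInterval_coe] at hr
    exact ⟨by linarith [hr.1], by linarith [hr.2]⟩
  have hs' : s ∈ timeInterval T := hsub ⟨le_rfl, hst.le⟩
  have hcongr : ∀ r ∈ timeInterval ((t - s : ℝ) : EReal), ∀ τ ∈ uIcc 0 r,
      lp.evalCLM ℝ E p i (g (s + τ)) =
        S.f i (ξ (s + τ) i) (ξ (min (s + τ) t)) (u (s + τ) i) := by
    intro r hr τ hτ
    have hr' := mem_timeInterval_coe.1 hr
    rw [uIcc_of_le hr'.1] at hτ
    have h1 : s + τ ≤ t := by linarith [hτ.2, hr'.2]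
    rw [min_eq_left h1]
    exact hg1 _ (hsub ⟨by linarith [hτ.1], h1⟩) i
  have hgi : ∀ r ∈ timeInterval ((t - s : ℝ) : EReal),
      IntervalIntegrable g volume s (s + r) := fun r hr =>
    (hg2 s hs').1.symm.trans (hg2 _ (hsub (hmem r hr))).1
  have hgs : ∀ r ∈ timeInterval ((t - s : ℝ) : EReal),
      IntervalIntegrable (fun τ => g (s + τ)) volume 0 r := fun r hr => by
    simpa using (hgi r hr).comp_add_left s
  refine ⟨by exact_mod_cast sub_pos.2 hst, ?_, fun r hr => ?_, fun r hr => ?_⟩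
  · refine (lp.evalCLM ℝ E p i).continuous.comp_continuousOn
      (h.continuousOn.comp (by fun_prop) fun r hr => hsub (hmem r hr))
  · have h1 : IntervalIntegrable (fun τ => lp.evalCLM ℝ E p i (g (s + τ))) volume 0 r :=
      ⟨(lp.evalCLM ℝ E p i).integrable_comp (hgs r hr).1,
        (lp.evalCLM ℝ E p i).integrable_comp (hgs r hr).2⟩
    exact h1.congr fun τ hτ => hcongr r hr τ (uIoc_subset_uIcc hτ)
  · rw [← intervalIntegral.integral_congr (hcongr r hr),
      (lp.evalCLM ℝ E p i).intervalIntegral_comp_comm (hgs r hr),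
      intervalIntegral.integral_comp_add_left g s, add_zero]
    have h1 := (hg2 _ (hsub (hmem r hr))).2
    rw [← intervalIntegral.integral_add_adjacent_intervals (hg2 s hs').1 (hgi r hr),
      ← add_assoc, ← (hg2 s hs').2] at h1
    rw [h1]
    rfl

variable [Fact (1 ≤ q)] {A : ∀ i, Set (E i)} {V : ∀ i, E i → ℝ}
  {αl αu lam : ℕ → ℝ} {γ : ℕ → ℕ → ℝ} {γu : ℕ → ℝ}

/-- A component that is outside `A i` at time `s` satisfies the dissipation inequality from then on,
even if it enters `A i` later. -/
theorem SubsystemLyapunov.dissipation_of_notMem [∀ i, CompleteSpace (E i)]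
    [∀ i, NormedSpace ℝ (F i)]
    (hV : S.SubsystemLyapunov q A V αl αu lam γ γu) (hu : EssBounded u)
    (h : S.IsSolution x0 u T ξ) (i : ℕ) {s t : ℝ} (hs : 0 ≤ s) (hst : s < t)
    (ht : t ∈ timeInterval T) (hsA : ξ s i ∉ A i) :
    (∀ r ∈ Ico s t, diniLowerRight (fun τ => V i (ξ τ i)) r < ⊤) ∧
    ∀ᵐ r : ℝ, r ∈ Ico s t → diniUpperRight (fun τ => V i (ξ τ i)) r ≤
      ((-lam i * V i (ξ r i) + γu i * ‖u r i‖ ^ q.toReal : ℝ) : EReal) +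
        ((∑' j, ENNReal.ofReal (γ i j * V j (ξ r j)) : ℝ≥0∞) : EReal) := by
  have hode := h.isODESolution_apply i hs hst ht
  have hxbar : ContinuousOn (fun r => ξ (min (s + r) t)) (Ici 0) := by
    refine h.continuousOn.comp (by fun_prop) fun r hr => ?_
    refine mem_timeInterval_of_le ?_ (min_le_right _ _) ht
    exact le_min (add_nonneg hs hr) (hs.trans hst.le)
  have hv := (hu.apply i).comp_const_add hs
  constructor
  · intro r hr
    have := hV.diniLower_lt_top i _ hsA _ _ hxbar hv _ _ hode (r - s)
      (mem_timeInterval_coe.2 ⟨by linarith [hr.1], by linarith [hr.2]⟩)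
    rwa [diniLowerRight_comp_const_add (fun τ => V i (ξ τ i)), add_sub_cancel] at this
  · have h1 := hV.dissipation i _ hsA _ _ hxbar hv _ _ hode
    have h2 := (measurePreserving_add_left (volume : Measure ℝ) (-s)).quasiMeasurePreserving.ae h1
    filter_upwards [h2] with r hr hrI
    have h3 := hr (mem_timeInterval_coe.2 ⟨by linarith [hrI.1], by linarith [hrI.2]⟩)
    rw [diniUpperRight_comp_const_add (fun τ => V i (ξ τ i))] at h3
    simpa only [add_neg_cancel_left, min_eq_left hrI.2.le] using h3

end InfiniteNetwork

end

section

variable {E F : ℕ → Type*} [∀ i, NormedAddCommGroup (E i)] [∀ i, NormedSpace ℝ (E i)]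
  [∀ i, NormedAddCommGroup (F i)] {p q : ℝ≥0∞} [Fact (1 ≤ p)]

namespace InfiniteNetwork

variable {S : InfiniteNetwork E F p} {x0 : lp E p} {u : ℝ → lp F q} {T : EReal} {ξ : ℝ → lp E p}
  {A : ∀ i, Set (E i)} {V : ∀ i, E i → ℝ} {αl αu lam : ℕ → ℝ} {γ : ℕ → ℕ → ℝ} {γu : ℕ → ℝ}

theorem SubsystemLyapunov.γ_nonneg (hV : S.SubsystemLyapunov q A V αl αu lam γ γu) (i j : ℕ) :
    0 ≤ γ i j := by
  by_cases h : j ∈ inputNeighbors (S.f i)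
  · exact (hV.γ_pos i j h).le
  · exact (hV.γ_zero i j h).ge

theorem SubsystemLyapunov.eq_zero_of_mem (hV : S.SubsystemLyapunov q A V αl αu lam γ γu)
    (hp : 0 < p.toReal) {i : ℕ} {x : E i} (hx : x ∈ A i) : V i x = 0 := by
  refine le_antisymm ?_ (hV.nonneg i x)
  simpa [Metric.infDist_zero_of_mem hx, Real.zero_rpow hp.ne'] using (hV.coercive i x).2

theorem IsSolution.continuousOn_apply (h : S.IsSolution x0 u T ξ) (i : ℕ) {s t : ℝ} (hs : 0 ≤ s)
    (ht : t ∈ timeInterval T) : ContinuousOn (fun r => ξ r i) (Icc s t) :=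
  (lp.evalCLM ℝ E p i).continuous.comp_continuousOn
    (h.continuousOn.mono (Icc_subset_timeInterval hs ht))

theorem SubsystemLyapunov.aemeasurable_ofReal (hV : S.SubsystemLyapunov q A V αl αu lam γ γu)
    (h : S.IsSolution x0 u T ξ) (i : ℕ) {s t : ℝ} (hs : 0 ≤ s) (ht : t ∈ timeInterval T) :
    AEMeasurable (fun r => ENNReal.ofReal (V i (ξ r i))) (volume.restrict (Icc s t)) :=
  (((hV.continuous i).comp_continuousOn (h.continuousOn_apply i hs ht)).aemeasurable
    measurableSet_Icc).ennreal_ofReal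

variable [Fact (1 ≤ q)]

/-- The dissipation inequality of the `i`-th subsystem in integrated form, on any time interval.
Up to the infimum `τ` of the times at which the component is outside `A i`, the function `V i`
vanishes along it; after `τ`, the component can be restarted at times arbitrarily close to `τ`
at which it is outside `A i`. -/
theorem SubsystemLyapunov.integrated_dissipation [∀ i, CompleteSpace (E i)]
    [∀ i, NormedSpace ℝ (F i)]
    (hV : S.SubsystemLyapunov q A V αl αu lam γ γu) (hp : 0 < p.toReal) (hu : EssBounded u)
    (h : S.IsSolution x0 u T ξ) (i : ℕ) {s t : ℝ} (hs : 0 ≤ s) (hst : s ≤ t)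
    (ht : t ∈ timeInterval T) :
    ENNReal.ofReal (V i (ξ t i)) +
        ENNReal.ofReal (lam i) * ∫⁻ r in Icc s t, ENNReal.ofReal (V i (ξ r i)) ≤
      ENNReal.ofReal (V i (ξ s i)) +
        (∑' j, ENNReal.ofReal (γ i j) * ∫⁻ r in Icc s t, ENNReal.ofReal (V j (ξ r j))) +
        ENNReal.ofReal (γu i) * ∫⁻ r in Icc s t, ‖u r i‖ₑ ^ q.toReal := by
  set K : Set ℝ := {r ∈ Icc s t | ξ r i ∉ A i} with hK
  rcases K.eq_empty_or_nonempty with hKe | hKne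
  · have h0 : ∀ r ∈ Icc s t, ENNReal.ofReal (V i (ξ r i)) = 0 := fun r hr => by
      have : ξ r i ∈ A i := by
        by_contra hc
        exact (hKe ▸ (⟨hr, hc⟩ : r ∈ K) : r ∈ (∅ : Set ℝ))
      rw [hV.eq_zero_of_mem hp this, ENNReal.ofReal_zero]
    rw [h0 t ⟨hst, le_rfl⟩, setLIntegral_congr_fun measurableSet_Icc h0]
    simp
  have hKb : BddBelow K := ⟨s, fun r hr => hr.1.1⟩
  set τ := sInf K with hτ
  have hsτ : s ≤ τ := le_csInf hKne fun r hr => hr.1.1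
  have hτt : τ ≤ t := (csInf_le hKb hKne.some_mem).trans hKne.some_mem.1.2
  have hbefore : ∀ r ∈ Ico s τ, ξ r i ∈ A i := fun r hr => by
    by_contra hc
    exact absurd (csInf_le hKb (⟨⟨hr.1, hr.2.le.trans hτt⟩, hc⟩ : r ∈ K)) (not_le.2 hr.2)
  have hcont := h.continuousOn_apply i hs ht
  have hVτ : V i (ξ τ i) ≤ V i (ξ s i) := by
    rcases hsτ.eq_or_lt with heq | hlt
    · rw [← heq]
    · have hne : (𝓝[Ico s τ] τ).NeBot := by
        rw [nhdsWithin_Ico_eq_nhdsLT hlt]; infer_instance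
      have hmem : ξ τ i ∈ A i := (hV.isClosed i).mem_of_tendsto
        ((hcont τ ⟨hsτ, hτt⟩).mono (Ico_subset_Icc_self.trans (Icc_subset_Icc le_rfl hτt))).tendsto
        (eventually_of_mem self_mem_nhdsWithin hbefore)
      rw [hV.eq_zero_of_mem hp hmem]
      exact hV.nonneg _ _
  obtain ⟨z, -, hzt, hzK⟩ := exists_seq_tendsto_sInf hKne hKb
  have hdis := fun n (hn : z n < t) =>
    hV.dissipation_of_notMem hu h i (hs.trans (hzK n).1.1) hn ht (hzK n).2
  have hτ0 : 0 ≤ τ := hs.trans hsτ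
  have huτ := (hu.apply i).mono_measure (Measure.restrict_mono
    (Icc_subset_Ici_self.trans (Ici_subset_Ici.2 hτ0) : Icc τ t ⊆ Ici 0) le_rfl)
  have hmain := ofReal_add_lintegral_le_of_diniUpperRight_le (f := fun r => V i (ξ r i))
    (P := fun r => γu i * ‖u r i‖ ^ q.toReal)
    (Q := fun r => ∑' j, ENNReal.ofReal (γ i j * V j (ξ r j))) (L := lam i) hτt (hV.lam_pos i).le
    ((hV.continuous i).comp_continuousOn (h.continuousOn_apply i hτ0 ht))
    (fun r => hV.nonneg _ _) (fun r => mul_nonneg (hV.γu_pos i).le (by positivity))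
    ((huτ.aestronglyMeasurable.norm.aemeasurable.pow_const _).const_mul _)
    (AEMeasurable.tsum fun j => (((hV.continuous j).comp_continuousOn
      (h.continuousOn_apply j hτ0 ht)).aemeasurable measurableSet_Icc).const_mul _
        |>.ennreal_ofReal)
    (fun r hr => by
      obtain ⟨n, hn⟩ := (hzt.eventually (gt_mem_nhds hr.1)).exists
      exact (hdis n (hn.trans hr.2)).1 r ⟨hn.le, hr.2⟩)
    (by
      have hall : ∀ᵐ r : ℝ, ∀ n, r ∈ Ico (z n) t → diniUpperRight (fun τ => V i (ξ τ i)) r ≤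
          ((-lam i * V i (ξ r i) + γu i * ‖u r i‖ ^ q.toReal : ℝ) : EReal) +
            ((∑' j, ENNReal.ofReal (γ i j * V j (ξ r j)) : ℝ≥0∞) : EReal) := by
        refine ae_all_iff.2 fun n => ?_
        by_cases hn : z n < t
        · exact (hdis n hn).2
        · exact Eventually.of_forall fun r hr => absurd (hr.1.trans_lt hr.2) hn
      filter_upwards [hall] with r hr hrI
      obtain ⟨n, hn⟩ := (hzt.eventually (gt_mem_nhds hrI.1)).exists
      exact hr n ⟨hn.le, hrI.2⟩)
  have hIτ : ∫⁻ r in Icc s t, ENNReal.ofReal (V i (ξ r i)) =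
      ∫⁻ r in Icc τ t, ENNReal.ofReal (V i (ξ r i)) := by
    have : Icc τ t = Icc τ t ∩ Icc s t :=
      (inter_eq_self_of_subset_left (Icc_subset_Icc hsτ le_rfl)).symm
    rw [this, ← setLIntegral_indicator measurableSet_Icc]
    refine setLIntegral_congr_fun measurableSet_Icc fun r hr => ?_
    by_cases hrτ : τ ≤ r
    · rw [indicator_of_mem (show r ∈ Icc τ t from ⟨hrτ, hr.2⟩)]
    · rw [indicator_of_notMem fun hc => hrτ hc.1,
        hV.eq_zero_of_mem hp (hbefore r ⟨hr.1, not_le.1 hrτ⟩), ENNReal.ofReal_zero]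
  rw [hIτ]
  refine hmain.trans ?_
  rw [add_assoc]
  gcongr ?_ + ?_
  · exact ENNReal.ofReal_le_ofReal hVτ
  refine (lintegral_mono_set (Icc_subset_Icc hsτ le_rfl)).trans_eq ?_
  have hm := fun j => hV.aemeasurable_ofReal h j hs ht
  simp only [ENNReal.ofReal_mul (hV.γ_nonneg _ _), ENNReal.ofReal_mul (hV.γu_pos _).le]
  rw [lintegral_add_right' _ (AEMeasurable.tsum fun j => (hm j).const_mul _),
    lintegral_tsum fun j => (hm j).const_mul _, add_comm]
  congr 1
  · simp only [lintegral_const_mul' _ _ ENNReal.ofReal_ne_top]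
  · rw [lintegral_const_mul' _ _ ENNReal.ofReal_ne_top]
    congr 1
    refine lintegral_congr fun r => ?_
    rw [← ENNReal.ofReal_rpow_of_nonneg (norm_nonneg _) ENNReal.toReal_nonneg, ofReal_norm]

end InfiniteNetwork

end

section

/-! ### Weights from the small-gain condition -/

theorem summable_norm_pow_of_spectralRadius_lt_one {R : Type*} [NormedRing R] [NormedAlgebra ℂ R]
    [CompleteSpace R] {a : R} (ha : spectralRadius ℂ a < 1) : Summable fun n : ℕ => ‖a ^ n‖ := by
  obtain ⟨r, har, hr1⟩ := ENNReal.lt_iff_exists_nnreal_btwn.1 ha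
  have hr1' : (r : ℝ) < 1 := by exact_mod_cast hr1
  have hev := (spectrum.pow_nnnorm_pow_one_div_tendsto_nhds_spectralRadius a).eventually
    (gt_mem_nhds har)
  refine Summable.of_norm_bounded_eventually_nat
    (summable_geometric_of_lt_one r.coe_nonneg hr1') ?_
  filter_upwards [hev, eventually_gt_atTop 0] with n hn hn0
  have h1 : (‖a ^ n‖₊ : ℝ≥0∞) < (r : ℝ≥0∞) ^ (n : ℝ) := by
    rw [one_div] at hn
    exact (ENNReal.rpow_inv_lt_iff (by exact_mod_cast hn0)).1 hn
  rw [ENNReal.rpow_natCast] at h1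
  have h2 : ‖a ^ n‖₊ < r ^ n := by exact_mod_cast h1
  rw [norm_norm]
  exact_mod_cast h2.le

theorem EllOne.enorm_eq (x : EllOne) : ‖x‖ₑ = ∑' j, ‖x j‖ₑ := by
  rw [← ofReal_norm, x.norm_eq, ENNReal.ofReal_tsum_of_nonneg (fun _ => norm_nonneg _)
    x.summable_norm]
  simp only [ofReal_norm]

theorem matrixOperator_apply_of_nonneg {M : ℕ → ℕ → ℝ} (hM : BoundedColumns M)
    (hM0 : ∀ i j, 0 ≤ M i j) {x : EllOne} (hx : ∀ j, x j = (‖x j‖ : ℂ)) (i : ℕ) :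
    matrixOperator M hM x i = (‖matrixOperator M hM x i‖ : ℂ) ∧
      ‖matrixOperator M hM x i‖ₑ = ∑' j, ENNReal.ofReal (M i j) * ‖x j‖ₑ := by
  have h0 : ∀ j, 0 ≤ M i j * ‖x j‖ := fun j => mul_nonneg (hM0 i j) (norm_nonneg _)
  have hs : Summable fun j => M i j * ‖x j‖ := by
    refine (summable_matrix_row hM x i).norm.congr fun j => ?_
    rw [norm_mul, Complex.norm_real, Real.norm_of_nonneg (hM0 i j)]
  have h1 : matrixOperator M hM x i = ((∑' j, M i j * ‖x j‖ : ℝ) : ℂ) := by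
    rw [matrixOperator_apply, Complex.ofReal_tsum]
    refine tsum_congr fun j => ?_
    rw [Complex.ofReal_mul, ← hx j]
  have h2 : ‖matrixOperator M hM x i‖ = ∑' j, M i j * ‖x j‖ := by
    rw [h1, Complex.norm_real, Real.norm_of_nonneg (tsum_nonneg h0)]
  refine ⟨by rw [h2, h1], ?_⟩
  rw [← ofReal_norm, h2, ENNReal.ofReal_tsum_of_nonneg h0 hs]
  refine tsum_congr fun j => ?_
  rw [ENNReal.ofReal_mul (hM0 i j), ofReal_norm]

/-- The `j`-th column sum of `Γ Ψ ^ k`, where `Ψ = Λ⁻¹ Γ`, computed in `[0, ∞]`. -/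
noncomputable def gainColumnSum (lam : ℕ → ℝ) (γ : ℕ → ℕ → ℝ) : ℕ → ℕ → ℝ≥0∞
  | 0, j => ∑' i, ENNReal.ofReal (γ i j)
  | k + 1, j => ∑' i, gainColumnSum lam γ k i * ENNReal.ofReal (γ i j / lam i)

theorem tsum_gainColumnSum_mul {lam : ℕ → ℝ} {γ : ℕ → ℕ → ℝ} {c : ℝ} (hc : 0 < c)
    (hlam : ∀ i, c ≤ lam i) (hγ : BoundedColumns γ) (hγ0 : ∀ i j, 0 ≤ γ i j) (k : ℕ) {x : EllOne}
    (hx : ∀ j, x j = (‖x j‖ : ℂ)) :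
    ∑' j, gainColumnSum lam γ k j * ‖x j‖ₑ =
      ‖matrixOperator γ hγ ((gainOperator lam γ hc hlam hγ ^ k) x)‖ₑ := by
  induction k generalizing x with
  | zero =>
    rw [pow_zero, one_apply_eq_self, EllOne.enorm_eq]
    simp only [gainColumnSum, (matrixOperator_apply_of_nonneg hγ hγ0 hx _).2,
      ← ENNReal.tsum_mul_right]
    exact ENNReal.tsum_comm
  | succ k ih =>
    have hΨ : ∀ i, gainOperator lam γ hc hlam hγ x i = (‖gainOperator lam γ hc hlam hγ x i‖ : ℂ) ∧
        ‖gainOperator lam γ hc hlam hγ x i‖ₑ =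
          ∑' j, ENNReal.ofReal (γ i j / lam i) * ‖x j‖ₑ :=
      matrixOperator_apply_of_nonneg (hγ.div_rows hc hlam)
        (fun i j => div_nonneg (hγ0 i j) (hc.le.trans (hlam i))) hx
    rw [pow_succ, mul_apply_eq_comp, ← ih fun i => (hΨ i).1]
    simp only [(hΨ _).2, gainColumnSum, ← ENNReal.tsum_mul_right,
      ← ENNReal.tsum_mul_left, mul_assoc]
    exact ENNReal.tsum_comm

/-- The small-gain condition gives a bounded nonnegative vector `w` such that the weights
`μ = 1 + Λ⁻¹ w` satisfy `Γᵀ μ = w`, that is, `Γᵀ μ - Λ μ = -Λ 1`. It is the vector of the column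
sums of `∑ₖ Γ Ψ ^ k`, a series that converges because `r(Ψ) < 1`. -/
theorem exists_weights {lam : ℕ → ℝ} {γ : ℕ → ℕ → ℝ} {c : ℝ} (hc : 0 < c)
    (hlam : ∀ i, c ≤ lam i) (hγ : BoundedColumns γ) (hγ0 : ∀ i j, 0 ≤ γ i j)
    (hr : spectralRadius ℂ (gainOperator lam γ hc hlam hγ) < 1) :
    ∃ (w : ℕ → ℝ) (B : ℝ), (∀ j, 0 ≤ w j ∧ w j ≤ B) ∧
      ∀ j, ∑' i, ENNReal.ofReal (1 + w i / lam i) * ENNReal.ofReal (γ i j) =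
        ENNReal.ofReal (w j) := by
  set Ψ := gainOperator lam γ hc hlam hγ with hΨ
  set W : ℕ → ℝ≥0∞ := fun j => ∑' k, gainColumnSum lam γ k j with hW
  set B : ℝ≥0∞ := ‖matrixOperator γ hγ‖ₑ * ∑' k, ‖Ψ ^ k‖ₑ with hB
  have hBfin : B ≠ ⊤ := by
    refine ENNReal.mul_ne_top enorm_ne_top ?_
    have h := summable_norm_pow_of_spectralRadius_lt_one hr
    simp only [← ofReal_norm]
    rw [← ENNReal.ofReal_tsum_of_nonneg (fun _ => norm_nonneg _) h]
    exact ENNReal.ofReal_ne_top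
  have hWB : ∀ j, W j ≤ B := fun j => by
    have hnorm : ‖(lp.single 1 j (1 : ℂ) : EllOne)‖ₑ = 1 := by
      rw [← ofReal_norm, lp.norm_single (by norm_num), norm_one, ENNReal.ofReal_one]
    rw [hB, ← ENNReal.tsum_mul_left]
    refine ENNReal.tsum_le_tsum fun k => ?_
    have h1 := tsum_gainColumnSum_mul hc hlam hγ hγ0 k (x := lp.single 1 j (1 : ℂ)) (fun l => by
      rcases eq_or_ne l j with rfl | hl
      · simp
      · simp [hl])
    rw [tsum_eq_single j (fun l hl => by simp [hl])] at h1
    simp only [lp.single_apply_self, enorm_one, mul_one] at h1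
    rw [h1]
    refine (ContinuousLinearMap.le_opENorm _ _).trans ?_
    gcongr
    refine (ContinuousLinearMap.le_opENorm _ _).trans_eq ?_
    rw [hnorm, mul_one]
  have hWfin : ∀ j, W j ≠ ⊤ := fun j => ((hWB j).trans_lt hBfin.lt_top).ne
  have hrec : ∀ j, W j =
      ∑' i, ENNReal.ofReal (γ i j) + ∑' i, W i * ENNReal.ofReal (γ i j / lam i) := fun j => by
    simp only [hW]
    rw [tsum_eq_zero_add' (f := fun k => gainColumnSum lam γ k j) ENNReal.summable]
    simp only [gainColumnSum, ← ENNReal.tsum_mul_right]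
    rw [ENNReal.tsum_comm]
  refine ⟨fun j => (W j).toReal, B.toReal, fun j =>
    ⟨ENNReal.toReal_nonneg, ENNReal.toReal_mono hBfin (hWB j)⟩, fun j => ?_⟩
  rw [ENNReal.ofReal_toReal (hWfin j), hrec j, ← ENNReal.tsum_add]
  refine tsum_congr fun i => ?_
  have hl : 0 < lam i := hc.trans_le (hlam i)
  rw [← ENNReal.ofReal_mul (by positivity), ← ENNReal.ofReal_toReal (hWfin i),
    ← ENNReal.ofReal_mul ENNReal.toReal_nonneg,
    ← ENNReal.ofReal_add (hγ0 i j) (mul_nonneg ENNReal.toReal_nonneg (div_nonneg (hγ0 i j) hl.le))]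
  congr 1
  ring

end

section

/-! ### Sums of coordinate functions on `ℓ^p` -/

theorem lowerSemicontinuous_tsum_of_nonneg {ι X : Type*} [TopologicalSpace X] {f : ι → X → ℝ}
    (hf : ∀ i, Continuous (f i)) (hf0 : ∀ i x, 0 ≤ f i x) (hs : ∀ x, Summable fun i => f i x) :
    LowerSemicontinuous fun x => ∑' i, f i x := by
  intro x y hy
  obtain ⟨s, hys⟩ := ((hs x).hasSum.eventually (lt_mem_nhds hy)).exists
  have hc : Continuous fun z => ∑ i ∈ s, f i z := continuous_finsetSum s fun i _ => hf i
  filter_upwards [hc.continuousAt.eventually (lt_mem_nhds hys)] with z hz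
  exact hz.trans_le ((hs z).sum_le_tsum s fun i _ => hf0 i z)

/-- A dominated convergence principle for pointwise sums: a sum of nonnegative continuous functions
is continuous if it is dominated termwise by a sum with a continuous value. Indeed, both the sum and
its difference from the dominating sum are lower semicontinuous. -/
theorem continuous_tsum_of_nonneg_of_le {ι X : Type*} [TopologicalSpace X] {f g : ι → X → ℝ}
    (hf : ∀ i, Continuous (f i)) (hg : ∀ i, Continuous (g i)) (hf0 : ∀ i x, 0 ≤ f i x)
    (hfg : ∀ i x, f i x ≤ g i x) (hs : ∀ x, Summable fun i => g i x)
    (hc : Continuous fun x => ∑' i, g i x) : Continuous fun x => ∑' i, f i x := by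
  have hfs : ∀ x, Summable fun i => f i x := fun x =>
    (hs x).of_nonneg_of_le (fun i => hf0 i x) fun i => hfg i x
  have h1 := lowerSemicontinuous_tsum_of_nonneg hf hf0 hfs
  have h2 := lowerSemicontinuous_tsum_of_nonneg (f := fun i x => g i x - f i x)
    (fun i => (hg i).sub (hf i)) (fun i x => sub_nonneg.2 (hfg i x)) fun x => (hs x).sub (hfs x)
  refine continuous_iff_lower_upperSemicontinuous.2 ⟨h1, ?_⟩
  have h3 : (fun x => ∑' i, f i x) =
      fun x => (∑' i, g i x) + -(∑' i, (g i x - f i x)) := by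
    funext x
    rw [(hs x).tsum_sub (hfs x)]
    ring
  rw [h3]
  exact hc.upperSemicontinuous.add (continuous_neg.comp_lowerSemicontinuous_antitone h2
    fun a b hab => neg_le_neg hab)

variable {E : ℕ → Type*} [∀ i, NormedAddCommGroup (E i)] {p : ℝ≥0∞} [Fact (1 ≤ p)]
  {A : ∀ i, Set (E i)}

theorem isClosed_lpProductSet (hA : ∀ i, IsClosed (A i)) : IsClosed (lpProductSet p A) := by
  have : lpProductSet p A = ⋂ i, (fun x : lp E p => x i) ⁻¹' A i := by
    ext x; simp [lpProductSet]
  rw [this]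
  exact isClosed_iInter fun i =>
    (hA i).preimage (lp.lipschitzWith_one_eval p i).continuous

/-- The distance to `X ∩ (A_1 × A_2 × …)` is attained coordinatewise. -/
theorem hasSum_infDist_rpow [∀ i, ProperSpace (E i)] (hp : 0 < p.toReal)
    (hAc : ∀ i, IsClosed (A i)) (hA : (lpProductSet p A).Nonempty) (x : lp E p) :
    HasSum (fun i => Metric.infDist (x i) (A i) ^ p.toReal)
      (Metric.infDist x (lpProductSet p A) ^ p.toReal) := by
  have hsum : ∀ b : lp E p, HasSum (fun i => dist (x i) (b i) ^ p.toReal) (dist x b ^ p.toReal) :=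
    fun b => by simpa [dist_eq_norm] using lp.hasSum_norm hp (x - b)
  have hle : ∀ b ∈ lpProductSet p A, ∀ i,
      Metric.infDist (x i) (A i) ^ p.toReal ≤ dist (x i) (b i) ^ p.toReal := fun b hb i =>
    Real.rpow_le_rpow Metric.infDist_nonneg (Metric.infDist_le_dist_of_mem (hb i)) hp.le
  obtain ⟨b, hb⟩ := hA
  choose a haA ha using fun i => (hAc i).exists_infDist_eq_dist ⟨b i, hb i⟩ (x i)
  have hmem : Memℓp (fun i => x i - a i) p := by
    refine memℓp_gen ((hsum b).summable.of_nonneg_of_le (fun i => by positivity) fun i => ?_)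
    rw [← dist_eq_norm, ← ha i]
    exact hle b hb i
  let a' : lp E p := x - ⟨fun i => x i - a i, hmem⟩
  have ha' : ∀ i, a' i = a i := fun i => sub_sub_cancel (x i) (a i)
  have hs := hsum a'
  simp only [ha', ← ha] at hs
  have hdist : Metric.infDist x (lpProductSet p A) = dist x a' := by
    refine le_antisymm (Metric.infDist_le_dist_of_mem fun i => by rw [ha']; exact haA i)
      ((Metric.le_infDist ⟨b, hb⟩).2 fun c hc => ?_)
    exact (Real.rpow_le_rpow_iff dist_nonneg dist_nonneg hp).1
      (hasSum_le (hle c hc) hs (hsum c))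
  rwa [hdist]

section WeightedSum

variable {V : ∀ i, E i → ℝ} {αlow αup : ℝ}

/-- Coercivity of the weighted sum `x ↦ ∑ μ i * V i (x i)`, which in particular converges. -/
theorem weightedSum_bounds [∀ i, ProperSpace (E i)] (hp : 0 < p.toReal)
    (hAc : ∀ i, IsClosed (A i)) (hA : (lpProductSet p A).Nonempty) (hαlow : 0 ≤ αlow)
    (hV : ∀ i x, αlow * Metric.infDist x (A i) ^ p.toReal ≤ V i x ∧
      V i x ≤ αup * Metric.infDist x (A i) ^ p.toReal)
    {μ : ℕ → ℝ} {μlow μup : ℝ} (hμlow : 0 ≤ μlow) (hμ : ∀ i, μlow ≤ μ i ∧ μ i ≤ μup)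
    (x : lp E p) :
    Summable (fun i => μ i * V i (x i)) ∧
      μlow * αlow * Metric.infDist x (lpProductSet p A) ^ p.toReal ≤ ∑' i, μ i * V i (x i) ∧
      ∑' i, μ i * V i (x i) ≤ μup * αup * Metric.infDist x (lpProductSet p A) ^ p.toReal := by
  have hd := hasSum_infDist_rpow hp hAc hA x
  have hd0 : ∀ i, 0 ≤ Metric.infDist (x i) (A i) ^ p.toReal := fun i =>
    Real.rpow_nonneg Metric.infDist_nonneg _
  have hV0 : ∀ i, 0 ≤ V i (x i) := fun i => (mul_nonneg hαlow (hd0 i)).trans (hV i (x i)).1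
  have hlo : ∀ i, μlow * αlow * Metric.infDist (x i) (A i) ^ p.toReal ≤ μ i * V i (x i) :=
    fun i => by
    rw [mul_assoc]
    exact mul_le_mul (hμ i).1 (hV i _).1 (mul_nonneg hαlow (hd0 i)) (hμlow.trans (hμ i).1)
  have hup : ∀ i, μ i * V i (x i) ≤ μup * αup * Metric.infDist (x i) (A i) ^ p.toReal := fun i => by
    rw [mul_assoc]
    exact mul_le_mul (hμ i).2 (hV i _).2 (hV0 i) (hμlow.trans ((hμ i).1.trans (hμ i).2))
  have hs : Summable fun i => μ i * V i (x i) :=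
    (hd.summable.mul_left (μup * αup)).of_nonneg_of_le
      (fun i => mul_nonneg (hμlow.trans (hμ i).1) (hV0 i)) hup
  exact ⟨hs, hasSum_le hlo (hd.mul_left _) hs.hasSum, hasSum_le hup hs.hasSum (hd.mul_left _)⟩

theorem continuous_weightedSum [∀ i, ProperSpace (E i)] (hp : 0 < p.toReal)
    (hAc : ∀ i, IsClosed (A i)) (hA : (lpProductSet p A).Nonempty) (hVc : ∀ i, Continuous (V i))
    (hV0 : ∀ i x, 0 ≤ V i x) (hV : ∀ i x, V i x ≤ αup * Metric.infDist x (A i) ^ p.toReal)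
    {μ : ℕ → ℝ} {μup : ℝ} (hμ : ∀ i, 0 ≤ μ i ∧ μ i ≤ μup) :
    Continuous fun x : lp E p => ∑' i, μ i * V i (x i) := by
  have heval : ∀ i, Continuous fun x : lp E p => x i := fun i =>
    (lp.lipschitzWith_one_eval p i).continuous
  have hd := fun x : lp E p => (hasSum_infDist_rpow hp hAc hA x).mul_left (μup * αup)
  refine continuous_tsum_of_nonneg_of_le
    (g := fun i (x : lp E p) => μup * αup * Metric.infDist (x i) (A i) ^ p.toReal)
    (fun i => continuous_const.mul ((hVc i).comp (heval i)))
    (fun i => continuous_const.mul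
      (((Metric.continuous_infDist_pt _).comp (heval i)).rpow_const fun _ => Or.inr hp.le))
    (fun i x => mul_nonneg (hμ i).1 (hV0 i _))
    (fun i x => ?_) (fun x => (hd x).summable) ?_
  · rw [mul_assoc]
    exact mul_le_mul (hμ i).2 (hV i _) (hV0 i _) ((hμ i).1.trans (hμ i).2)
  · simp only [(hd _).tsum_eq]
    exact continuous_const.mul
      ((Metric.continuous_infDist_pt _).rpow_const fun _ => Or.inr hp.le)

end WeightedSum

end

section

/-! ### Consequences of an integrated decay estimate -/

theorem eventually_sub_lt_of_integral_le {f : ℝ → ℝ} {s b κ C r : ℝ} (hsb : s < b) (hκ : 0 < κ)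
    (hf : ContinuousOn f (Ico s b))
    (h : ∀ t ∈ Ioo s b, f t + κ * ∫ τ in Icc s t, f τ ≤ f s + C * (t - s))
    (hr : -κ * f s + C < r) : ∀ᶠ t in 𝓝[>] s, f t - f s < r * (t - s) := by
  obtain ⟨m, hm, hmf⟩ : ∃ m < f s, -κ * m + C < r := by
    refine ⟨f s - (r + κ * f s - C) / (2 * κ), ?_, ?_⟩
    · have : 0 < (r + κ * f s - C) / (2 * κ) := div_pos (by linarith) (by linarith)
      linarith
    · have : κ * ((r + κ * f s - C) / (2 * κ)) = (r + κ * f s - C) / 2 := by field_simp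
      linarith
  have hev : ∀ᶠ t in 𝓝[≥] s, m < f t := by
    rw [← nhdsWithin_Ico_eq_nhdsGE hsb]
    exact (hf s (left_mem_Ico.2 hsb)).eventually (lt_mem_nhds hm)
  obtain ⟨c, hc, hcf⟩ := (mem_nhdsGE_iff_exists_Ico_subset).1 hev
  filter_upwards [Ioo_mem_nhdsGT (lt_min hc hsb)] with t ht
  have htb : t ∈ Ioo s b := ⟨ht.1, ht.2.trans_le (min_le_right _ _)⟩
  have hint : IntegrableOn f (Icc s t) :=
    (hf.mono fun τ hτ => ⟨hτ.1, hτ.2.trans_lt htb.2⟩).integrableOn_Icc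
  have h1 : m * (t - s) ≤ ∫ τ in Icc s t, f τ := by
    have h2 := setIntegral_mono_on (f := fun _ => m) (by simp) hint measurableSet_Icc fun τ hτ =>
      le_of_lt (hcf (show τ ∈ Ico s c from ⟨hτ.1, hτ.2.trans_lt (ht.2.trans_le (min_le_left _ _))⟩))
    rw [setIntegral_const, Real.volume_real_Icc_of_le ht.1.le, smul_eq_mul] at h2
    linarith
  have h3 := h t htb
  have h4 : 0 < t - s := sub_pos.2 ht.1
  nlinarith [mul_le_mul_of_nonneg_left h1 hκ.le, mul_lt_mul_of_pos_right hmf h4]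

theorem diniUpperRight_le_of_eventually {f : ℝ → ℝ} {c : ℝ}
    (h : ∀ r, c < r → ∀ᶠ t in 𝓝[>] (0 : ℝ), f t - f 0 < r * t) :
    diniUpperRight f 0 ≤ (c : EReal) := by
  refine EReal.le_of_forall_lt_iff_le.1 fun r hr => ?_
  refine limsup_le_of_le (by isBoundedDefault) ?_
  filter_upwards [h r (EReal.coe_lt_coe_iff.1 hr), self_mem_nhdsWithin] with t ht ht0
  rw [EReal.coe_le_coe_iff, zero_add]
  exact ((div_lt_iff₀ ht0).2 ht).le

theorem le_exp_of_integral_le {f : ℝ → ℝ} {b κ C : ℝ} (hκ : 0 < κ) (hC : 0 ≤ C)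
    (hf : ContinuousOn f (Icc 0 b))
    (h : ∀ s t, 0 ≤ s → s ≤ t → t ≤ b → f t + κ * ∫ τ in Icc s t, f τ ≤ f s + C * (t - s))
    (hb : 0 ≤ b) : f b ≤ f 0 * Real.exp (-κ * b) + C / κ := by
  have h1 := le_gronwallBound_of_liminf_deriv_right_le (f' := fun t => -κ * f t + C) (K := -κ)
    (ε := C) hf (fun s hs r hr => by
      have h2 := eventually_sub_lt_of_integral_le hs.2 hκ
        (hf.mono fun τ hτ => ⟨hs.1.trans hτ.1, hτ.2.le⟩)
        (fun t ht => h s t hs.1 ht.1.le ht.2.le) hr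
      refine Eventually.frequently ?_
      filter_upwards [h2, self_mem_nhdsWithin] with t ht hst
      have hst' : 0 < t - s := sub_pos.2 hst
      rwa [inv_mul_lt_iff₀ hst', mul_comm]) le_rfl (fun _ _ => le_rfl) b ⟨hb, le_rfl⟩
  rw [gronwallBound_of_K_ne_0 (neg_ne_zero.2 hκ.ne'), sub_zero] at h1
  refine h1.trans ?_
  beta_reduce
  have h3 : C / -κ * (Real.exp (-κ * b) - 1) = C / κ - C / κ * Real.exp (-κ * b) := by
    rw [div_neg]; ring
  rw [h3]
  have : 0 ≤ C / κ * Real.exp (-κ * b) := by positivity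
  linarith

/-! ### Decay of the weighted sum along solutions -/

variable {E F : ℕ → Type*} [∀ i, NormedAddCommGroup (E i)] [∀ i, NormedSpace ℝ (E i)]
  [∀ i, NormedAddCommGroup (F i)] {p q : ℝ≥0∞} [Fact (1 ≤ p)]
  [Fact (1 ≤ q)]

theorem lp.tsum_enorm_rpow (hq : 0 < q.toReal) (x : lp F q) :
    ∑' i, ‖x i‖ₑ ^ q.toReal = ‖x‖ₑ ^ q.toReal := by
  have h := lp.hasSum_norm hq x
  simp only [← ofReal_norm, ENNReal.ofReal_rpow_of_nonneg (norm_nonneg _) hq.le]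
  rw [← h.tsum_eq,
    ENNReal.ofReal_tsum_of_nonneg (fun i => by positivity) h.summable]

theorem EssBounded.lintegral_enorm_rpow_le {u : ℝ → lp F q} (hu : EssBounded u) {s t : ℝ}
    (hs : 0 ≤ s) :
    ∫⁻ r in Icc s t, ‖u r‖ₑ ^ q.toReal ≤
      ENNReal.ofReal (essSupNorm u ^ q.toReal * (t - s)) := by
  have h1 : ∀ᵐ r ∂(volume.restrict (Icc s t)), ‖u r‖ₑ ≤ ENNReal.ofReal (essSupNorm u) := by
    have h2 := ae_le_eLpNormEssSup (f := u) (μ := volume.restrict (Ici 0))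
    rw [essSupNorm, ENNReal.ofReal_toReal hu.2.ne, eLpNorm_exponent_top]
    exact ae_mono (Measure.restrict_mono (Icc_subset_Ici_self.trans (Ici_subset_Ici.2 hs)) le_rfl)
      h2
  have h0 : 0 ≤ essSupNorm u := ENNReal.toReal_nonneg
  calc ∫⁻ r in Icc s t, ‖u r‖ₑ ^ q.toReal
      ≤ ∫⁻ _ in Icc s t, ENNReal.ofReal (essSupNorm u ^ q.toReal) := by
        refine lintegral_mono_ae ?_
        filter_upwards [h1] with r hr
        rw [← ENNReal.ofReal_rpow_of_nonneg h0 ENNReal.toReal_nonneg]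
        exact ENNReal.rpow_le_rpow hr ENNReal.toReal_nonneg
    _ = _ := by
        rw [setLIntegral_const, Real.volume_Icc, ENNReal.ofReal_mul (by positivity)]

namespace InfiniteNetwork

variable {S : InfiniteNetwork E F p} {x0 : lp E p} {u : ℝ → lp F q} {T : EReal} {ξ : ℝ → lp E p}
  {A : ∀ i, Set (E i)} {V : ∀ i, E i → ℝ} {αl αu lam : ℕ → ℝ} {γ : ℕ → ℕ → ℝ} {γu : ℕ → ℝ}

/-- The integrated decay of the weighted sum along solutions. Summing the integrated dissipation
inequalities with the weights `μ i = 1 + w i / lam i`, the terms `∑ w j * ∫ V j` cancel and a decay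
term `∑ lam i * ∫ V i` remains. All sums are taken in `[0, ∞]`, so they may be interchanged
freely, even though the rates `lam i` need not be bounded above; what has to be checked is that the
cancelled sum is finite. -/
theorem SubsystemLyapunov.weightedSum_integral_le [∀ i, CompleteSpace (E i)]
    [∀ i, NormedSpace ℝ (F i)]
    (hV : S.SubsystemLyapunov q A V αl αu lam γ γu) (hp : 0 < p.toReal) (hq : 0 < q.toReal)
    (hu : EssBounded u) (h : S.IsSolution x0 u T ξ) {w : ℕ → ℝ} {B : ℝ}
    (hw : ∀ j, 0 ≤ w j ∧ w j ≤ B)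
    (hwγ : ∀ j, ∑' i, ENNReal.ofReal (1 + w i / lam i) * ENNReal.ofReal (γ i j) =
        ENNReal.ofReal (w j))
    {κ μup γup : ℝ} (hκ : 0 ≤ κ) (hμup : ∀ i, 1 + w i / lam i ≤ μup)
    (hκlam : ∀ i, κ * μup ≤ lam i) (hγup : ∀ i, γu i ≤ γup)
    (hs : ∀ x : lp E p, Summable fun i => (1 + w i / lam i) * V i (x i))
    (hc : Continuous fun x : lp E p => ∑' i, (1 + w i / lam i) * V i (x i))
    {s t : ℝ} (hs0 : 0 ≤ s) (hst : s ≤ t) (ht : t ∈ timeInterval T) :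
    ∑' i, (1 + w i / lam i) * V i (ξ t i) +
        κ * ∫ r in Icc s t, ∑' i, (1 + w i / lam i) * V i (ξ r i) ≤
      ∑' i, (1 + w i / lam i) * V i (ξ s i) +
        μup * γup * essSupNorm u ^ q.toReal * (t - s) := by
  set μ : ℕ → ℝ := fun i => 1 + w i / lam i with hμ
  have hμ1 : ∀ i, 1 ≤ μ i := fun i => by
    have := div_nonneg (hw i).1 (hV.lam_pos i).le
    simp only [hμ]; linarith
  have hμ0 : ∀ i, 0 ≤ μ i := fun i => zero_le_one.trans (hμ1 i)
  have hμup0 : 0 ≤ μup := (hμ0 0).trans (hμup 0)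
  have hγup0 : 0 ≤ γup := (hV.γu_pos 0).le.trans (hγup 0)
  have hW0 : ∀ x : lp E p, 0 ≤ ∑' i, μ i * V i (x i) := fun x =>
    tsum_nonneg fun i => mul_nonneg (hμ0 i) (hV.nonneg i _)
  have hWe : ∀ x : lp E p, ENNReal.ofReal (∑' i, μ i * V i (x i)) =
      ∑' i, ENNReal.ofReal (μ i) * ENNReal.ofReal (V i (x i)) := fun x => by
    rw [ENNReal.ofReal_tsum_of_nonneg (fun i => mul_nonneg (hμ0 i) (hV.nonneg i _)) (hs x)]
    simp only [ENNReal.ofReal_mul (hμ0 _)]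
  set I : ℕ → ℝ≥0∞ := fun j => ∫⁻ r in Icc s t, ENNReal.ofReal (V j (ξ r j)) with hI
  set J : ℕ → ℝ≥0∞ := fun j => ∫⁻ r in Icc s t, ‖u r j‖ₑ ^ q.toReal with hJ
  -- `∑ μ i * I i` is the integral of the weighted sum, in particular finite
  have hWint : IntegrableOn (fun r => ∑' i, μ i * V i (ξ r i)) (Icc s t) :=
    (hc.comp_continuousOn (h.continuousOn.mono
      (Icc_subset_timeInterval hs0 ht))).integrableOn_Icc
  have hWI : ∑' i, ENNReal.ofReal (μ i) * I i =
      ENNReal.ofReal (∫ r in Icc s t, ∑' i, μ i * V i (ξ r i)) := by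
    rw [ofReal_integral_eq_lintegral_ofReal hWint (Eventually.of_forall fun r => hW0 _)]
    simp only [hWe]
    rw [lintegral_tsum fun i => (hV.aemeasurable_ofReal h i hs0 ht).const_mul _]
    simp only [lintegral_const_mul' _ _ ENNReal.ofReal_ne_top, hI]
  have hwI : ∑' j, ENNReal.ofReal (w j) * I j ≠ ⊤ := by
    refine (lt_of_le_of_lt ?_ (ENNReal.mul_lt_top (ENNReal.ofReal_lt_top (r := B))
      (hWI ▸ ENNReal.ofReal_lt_top : ∑' i, ENNReal.ofReal (μ i) * I i < ⊤))).ne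
    rw [← ENNReal.tsum_mul_left]
    refine ENNReal.tsum_le_tsum fun j => ?_
    rw [← mul_assoc, ← ENNReal.ofReal_mul ((hw j).1.trans (hw j).2)]
    gcongr
    have := (hw j).1.trans (hw j).2
    nlinarith [hμ1 j, (hw j).2]
  have hJle : ∑' i, J i ≤ ENNReal.ofReal (essSupNorm u ^ q.toReal * (t - s)) := by
    rw [hJ, ← lintegral_tsum]
    · simp only [lp.tsum_enorm_rpow hq]
      exact hu.lintegral_enorm_rpow_le hs0
    · intro i
      have hui := (hu.apply i).mono_measure (Measure.restrict_mono
        (Icc_subset_Ici_self.trans (Ici_subset_Ici.2 hs0) : Icc s t ⊆ Ici 0) le_rfl)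
      exact hui.aestronglyMeasurable.enorm.pow_const _
  have hμlam : ∀ i, ENNReal.ofReal (μ i) * ENNReal.ofReal (lam i) =
      ENNReal.ofReal (lam i) + ENNReal.ofReal (w i) := fun i => by
    rw [← ENNReal.ofReal_mul (hμ0 i), ← ENNReal.ofReal_add (hV.lam_pos i).le (hw i).1]
    congr 1
    have := (hV.lam_pos i).ne'
    simp only [hμ]
    field_simp
  have hsum : (∑' i, ENNReal.ofReal (μ i) * ENNReal.ofReal (V i (ξ t i)) +
      ∑' i, ENNReal.ofReal (lam i) * I i) + ∑' i, ENNReal.ofReal (w i) * I i ≤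
      (∑' i, ENNReal.ofReal (μ i) * ENNReal.ofReal (V i (ξ s i)) +
        ENNReal.ofReal (μup * γup) * ∑' i, J i) + ∑' i, ENNReal.ofReal (w i) * I i := by
    have h1 : ∑' i, ENNReal.ofReal (w i) * I i =
        ∑' i, ENNReal.ofReal (μ i) * ∑' j, ENNReal.ofReal (γ i j) * I j := by
      simp only [← hwγ, ← ENNReal.tsum_mul_right, ← ENNReal.tsum_mul_left, mul_assoc, hμ]
      exact ENNReal.tsum_comm
    conv_rhs => rw [h1]
    rw [← ENNReal.tsum_add, ← ENNReal.tsum_add, ← ENNReal.tsum_mul_left, ← ENNReal.tsum_add,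
      ← ENNReal.tsum_add]
    refine ENNReal.tsum_le_tsum fun i => ?_
    calc ENNReal.ofReal (μ i) * ENNReal.ofReal (V i (ξ t i)) + ENNReal.ofReal (lam i) * I i +
          ENNReal.ofReal (w i) * I i
        = ENNReal.ofReal (μ i) * (ENNReal.ofReal (V i (ξ t i)) + ENNReal.ofReal (lam i) * I i) := by
          rw [mul_add, ← mul_assoc, hμlam]; ring
      _ ≤ ENNReal.ofReal (μ i) * (ENNReal.ofReal (V i (ξ s i)) +
            (∑' j, ENNReal.ofReal (γ i j) * I j) + ENNReal.ofReal (γu i) * J i) := by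
          exact mul_le_mul_right (hV.integrated_dissipation hp hu h i hs0 hst ht) _
      _ = ENNReal.ofReal (μ i) * ENNReal.ofReal (V i (ξ s i)) +
            ENNReal.ofReal (μ i * γu i) * J i +
            ENNReal.ofReal (μ i) * ∑' j, ENNReal.ofReal (γ i j) * I j := by
          rw [ENNReal.ofReal_mul (hμ0 i)]; ring
      _ ≤ _ := by
          gcongr
          exacts [(hV.γu_pos i).le, hμup i, hγup i]
  have hmain := ENNReal.le_of_add_le_add_right hwI hsum
  have hκI : ENNReal.ofReal κ * ∑' i, ENNReal.ofReal (μ i) * I i ≤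
      ∑' i, ENNReal.ofReal (lam i) * I i := by
    rw [← ENNReal.tsum_mul_left]
    refine ENNReal.tsum_le_tsum fun i => ?_
    rw [← mul_assoc, ← ENNReal.ofReal_mul hκ]
    gcongr
    exact (mul_le_mul_of_nonneg_left (hμup i) hκ).trans (hκlam i)
  have hfinal := (add_le_add_right hκI
    (∑' i, ENNReal.ofReal (μ i) * ENNReal.ofReal (V i (ξ t i)))).trans
      (hmain.trans (add_le_add_right (mul_le_mul_right hJle (ENNReal.ofReal (μup * γup)))
        (∑' i, ENNReal.ofReal (μ i) * ENNReal.ofReal (V i (ξ s i)))))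
  have hn : 0 ≤ essSupNorm u ^ q.toReal := Real.rpow_nonneg ENNReal.toReal_nonneg _
  have hts : 0 ≤ essSupNorm u ^ q.toReal * (t - s) := mul_nonneg hn (sub_nonneg.2 hst)
  rw [hWI, ← hWe, ← hWe, ← ENNReal.ofReal_mul hκ,
    ← ENNReal.ofReal_mul (mul_nonneg hμup0 hγup0),
    ← ENNReal.ofReal_add (hW0 _) (mul_nonneg hκ (integral_nonneg fun r => hW0 _)),
    ← ENNReal.ofReal_add (hW0 _) (mul_nonneg (mul_nonneg hμup0 hγup0) hts),
    ENNReal.ofReal_le_ofReal_iff (add_nonneg (hW0 _)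
      (mul_nonneg (mul_nonneg hμup0 hγup0) hts)), ← mul_assoc] at hfinal
  exact hfinal

end InfiniteNetwork

end

section

/-! ### Comparison functions and the exponential estimate -/

theorem isClassKInf_mul_rpow {K r : ℝ} (hK : 0 < K) (hr : 0 < r) :
    IsClassKInf fun x => K * x ^ r where
  continuousOn := continuousOn_const.mul (continuousOn_id.rpow_const fun _ _ => Or.inr hr.le)
  strictMonoOn := fun _ hx _ _ hxy => mul_lt_mul_of_pos_left (Real.rpow_lt_rpow hx hxy hr) hK
  map_zero := by simp [Real.zero_rpow hr.ne']
  tendsto_atTop := (tendsto_rpow_atTop hr).const_mul_atTop hK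

theorem IsClassK.rpow {g : ℝ → ℝ} (hg : IsClassK g) {r : ℝ} (hr : 0 < r) :
    IsClassK fun x => g x ^ r where
  continuousOn := hg.continuousOn.rpow_const fun _ _ => Or.inr hr.le
  strictMonoOn := fun x hx y hy hxy => by
    refine Real.rpow_lt_rpow ?_ (hg.strictMonoOn hx hy hxy) hr
    rw [← hg.map_zero]
    exact hg.strictMonoOn.monotoneOn self_mem_Ici hx hx
  map_zero := by simp [hg.map_zero, Real.zero_rpow hr.ne']

theorem le_of_rpow_le_exp {P d d₀ a κ t c : ℝ} (hP : 1 ≤ P) (hd : 0 ≤ d) (hd₀ : 0 ≤ d₀) (ha : 0 ≤ a)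
    (hc : 0 ≤ c) (h : d ^ P ≤ a * Real.exp (-κ * t) * d₀ ^ P + c) :
    d ≤ a ^ P⁻¹ * Real.exp (-(κ / P) * t) * d₀ + c ^ P⁻¹ := by
  have hP0 : 0 < P := zero_lt_one.trans_le hP
  have h1 : 0 ≤ a ^ P⁻¹ * Real.exp (-(κ / P) * t) * d₀ := by positivity
  have h2 : 0 ≤ c ^ P⁻¹ := by positivity
  refine (Real.rpow_le_rpow_iff hd (add_nonneg h1 h2) hP0).1 (h.trans ?_)
  refine le_trans (le_of_eq ?_) (Real.add_rpow_le_rpow_add h1 h2 hP)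
  rw [Real.mul_rpow (by positivity) hd₀, Real.mul_rpow (by positivity) (Real.exp_nonneg _),
    Real.rpow_inv_rpow ha hP0.ne', Real.rpow_inv_rpow hc hP0.ne', ← Real.exp_mul]
  congr 4
  field_simp

/-! ### Maximal solutions -/

namespace InfiniteNetwork

variable {E F : ℕ → Type*} [∀ i, NormedAddCommGroup (E i)] [∀ i, NormedSpace ℝ (E i)]
  [∀ i, NormedAddCommGroup (F i)] {p q : ℝ≥0∞} [Fact (1 ≤ p)] [Fact (1 ≤ q)]
  {S : InfiniteNetwork E F p}

/-- The solutions for given data agree on their common domains, and glue to a maximal one. -/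
theorem WellPosed.exists_maximal (hwp : S.WellPosed q) (x0 : lp E p) {u : ℝ → lp F q}
    (hu : EssBounded u) : ∃ T ξ, S.IsSolution x0 u T ξ ∧
      ∀ T' ξ', S.IsSolution x0 u T' ξ' → T' ≤ T := by
  classical
  set Tm : EReal := sSup {T | ∃ ξ, S.IsSolution x0 u T ξ} with hTm
  have hle : ∀ T ξ, S.IsSolution x0 u T ξ → T ≤ Tm := fun T ξ h => le_sSup ⟨ξ, h⟩
  have hex : ∀ t, ∃ (T : EReal) (ξ g : ℝ → lp E p), t ∈ timeInterval Tm →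
      S.IsSolution x0 u T ξ ∧ t ∈ timeInterval T ∧
      (∀ s ∈ timeInterval T, ∀ i, g s i = S.f i (ξ s i) (ξ s) (u s i)) ∧
      ∀ s ∈ timeInterval T, IntervalIntegrable g volume 0 s ∧
        ξ s = x0 + ∫ r in (0 : ℝ)..s, g r := by
    intro t
    by_cases ht : t ∈ timeInterval Tm
    · obtain ⟨T, ⟨ξ, hξ⟩, htT⟩ := lt_sSup_iff.1 ht.2
      obtain ⟨g, hg1, hg2⟩ := hξ.eq_integral
      exact ⟨T, ξ, g, fun _ => ⟨hξ, ⟨ht.1, htT⟩, hg1, hg2⟩⟩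
    · exact ⟨0, 0, 0, fun h => absurd h ht⟩
  choose τ ζ G hsol hmem hG1 hG2 using hex
  have hsub : ∀ t ∈ timeInterval Tm, timeInterval (τ t) ⊆ timeInterval Tm := fun t ht s hs =>
    ⟨hs.1, hs.2.trans_le (hle _ _ (hsol t ht))⟩
  have hζ : ∀ t ∈ timeInterval Tm, ∀ s ∈ timeInterval (τ t), ζ s s = ζ t s := fun t ht s hs =>
    hwp.unique_local x0 u hu _ _ _ _ (hsol s (hsub t ht hs)) (hsol t ht) s
      ⟨hmem s (hsub t ht hs), hs⟩
  have hG : ∀ t ∈ timeInterval Tm, ∀ s ∈ timeInterval (τ t), G s s = G t s := fun t ht s hs => by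
    have hs' := hsub t ht hs
    refine lp.ext (funext fun i => ?_)
    rw [hG1 s hs' s (hmem s hs') i, hG1 t ht s hs i, hζ t ht s hs]
  refine ⟨Tm, fun t => ζ t t, ⟨?_, fun t ht => ?_, fun t => G t t, fun t ht i => ?_,
    fun t ht => ⟨?_, ?_⟩⟩, hle⟩
  · obtain ⟨T, ξ, h⟩ := hwp.exists_local x0 u hu
    exact h.pos.trans_le (hle _ _ h)
  · have hc := (hsol t ht).continuousOn t (hmem t ht)
    refine (hc.congr (hζ t ht) (hζ t ht t (hmem t ht))).mono_of_mem_nhdsWithin ?_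
    have hopen : {s : ℝ | (s : EReal) < τ t} ∈ 𝓝 t :=
      (isOpen_Iio.preimage continuous_coe_real_ereal).mem_nhds (hmem t ht).2
    filter_upwards [self_mem_nhdsWithin, mem_nhdsWithin_of_mem_nhds hopen] with s hs1 hs2
    exact ⟨hs1.1, hs2⟩
  · exact hG1 t ht t (hmem t ht) i
  · refine (hG2 t ht t (hmem t ht)).1.congr fun s hs => (hG t ht s ?_).symm
    rw [uIoc_of_le ht.1] at hs
    exact mem_timeInterval_of_le hs.1.le hs.2 (hmem t ht)
  · rw [intervalIntegral.integral_congr (g := G t) fun s hs => hG t ht s ?_]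
    · exact (hG2 t ht t (hmem t ht)).2
    · rw [uIcc_of_le ht.1] at hs
      exact mem_timeInterval_of_le hs.1 hs.2 (hmem t ht)

/-- Under an exponential estimate, the distance to the set stays bounded along every solution, so
under the continuation hypothesis a maximal solution cannot end at a finite time. -/
theorem HasExpEstimate.forwardComplete (hwp : S.WellPosed q) {A : Set (lp E p)} {M a : ℝ}
    {g : ℝ → ℝ} (hM : 0 ≤ M) (ha : 0 ≤ a) (h : S.HasExpEstimate q A M a g)
    (hcont : S.BoundedDistContinuation q A) : S.ForwardComplete q := by
  intro x0 u hu
  obtain ⟨T, ξ, hξ, hmax⟩ := hwp.exists_maximal x0 hu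
  rcases eq_or_ne T ⊤ with rfl | hT
  · exact ⟨ξ, hξ⟩
  · obtain ⟨T', ξ', hTT', hξ'⟩ := hcont x0 u hu T ξ hT.lt_top hξ
      ⟨M * Metric.infDist x0 A + g (essSupNorm u), fun t ht => (h x0 u hu T ξ hξ t ht).trans (by
        have h1 : Real.exp (-a * t) ≤ 1 := Real.exp_le_one_iff.2 (by nlinarith [ht.1])
        have h2 : 0 ≤ Metric.infDist x0 A := Metric.infDist_nonneg
        gcongr
        exact mul_le_of_le_one_right hM h1)⟩
    exact absurd (hmax T' ξ' hξ') (not_le.2 hTT')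

end InfiniteNetwork

end

/-! ### The small-gain theorem -/

theorem theorem1 {E F : ℕ → Type*}
    [∀ i, NormedAddCommGroup (E i)] [∀ i, NormedSpace ℝ (E i)] [∀ i, FiniteDimensional ℝ (E i)]
    [∀ i, NormedAddCommGroup (F i)] [∀ i, NormedSpace ℝ (F i)] [∀ i, FiniteDimensional ℝ (F i)]
    (p q : ℝ≥0∞) [Fact (1 ≤ p)] [Fact (1 ≤ q)] (hp : p ≠ ⊤) (hq : q ≠ ⊤)
    (S : InfiniteNetwork E F p)
    -- the interconnection is well-posed on `X = ℓ^p` with input values in `U = ℓ^q`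
    (hwp : S.WellPosed q)
    -- Lyapunov functions of the subsystems, with uniform constants
    (A : ∀ i, Set (E i)) (V : ∀ i, E i → ℝ) (αl αu lam : ℕ → ℝ) (γ : ℕ → ℕ → ℝ) (γu : ℕ → ℝ)
    (hV : S.SubsystemLyapunov q A V αl αu lam γ γu)
    (αlow αup lamlow γup : ℝ) (hαlow : 0 < αlow) (hαup : 0 < αup) (hlamlow : 0 < lamlow)
    (hγup : 0 < γup)
    (hα : ∀ i, αlow ≤ αl i ∧ αl i ≤ αu i ∧ αu i ≤ αup)
    (hlam : ∀ i, lamlow ≤ lam i)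
    (hγu : ∀ i, γu i ≤ γup)
    -- boundedness of `Γ` on `ℓ¹` and the small-gain condition
    (hΓ : BoundedColumns γ)
    (hr : spectralRadius ℂ (gainOperator lam γ hlamlow hlam hΓ) < 1)
    (hA : (lpProductSet p A).Nonempty) :
    (∃ (μ : ℕ → ℝ) (μlow μup : ℝ), 0 < μlow ∧ 0 < μup ∧ (∀ i, μlow ≤ μ i ∧ μ i ≤ μup) ∧
      (∀ x : lp E p, Summable fun i => μ i * V i (x i)) ∧
      S.IsEISSLyapunov q (lpProductSet p A) (fun x => ∑' i, μ i * V i (x i)) ∧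
      ContinuousOn (fun x : lp E p => ∑' i, μ i * V i (x i)) (lpProductSet p A)ᶜ ∧
      (∃ lamInf : ℝ, 0 < lamInf ∧
        S.OrbitalDecay q (lpProductSet p A) (fun x => ∑' i, μ i * V i (x i)) lamInf
          (fun r => μup * γup * r ^ q.toReal)) ∧
      (∀ x : lp E p,
        μlow * αlow * Metric.infDist x (lpProductSet p A) ^ p.toReal ≤ ∑' i, μ i * V i (x i) ∧
        ∑' i, μ i * V i (x i) ≤ μup * αup * Metric.infDist x (lpProductSet p A) ^ p.toReal)) ∧
    (∃ (M a : ℝ) (g : ℝ → ℝ), 0 < M ∧ 0 < a ∧ IsClassK g ∧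
      S.HasExpEstimate q (lpProductSet p A) M a g) ∧
    (S.BoundedDistContinuation q (lpProductSet p A) → S.IsEISS q (lpProductSet p A)) := by
  have : ∀ i, ProperSpace (E i) := fun i => FiniteDimensional.proper ℝ (E i)
  have : ∀ i, CompleteSpace (E i) := fun i => FiniteDimensional.complete ℝ (E i)
  have hP : 1 ≤ p.toReal := by
    simpa using ENNReal.toReal_mono hp (Fact.out : 1 ≤ p)
  have hQ : 1 ≤ q.toReal := by
    simpa using ENNReal.toReal_mono hq (Fact.out : 1 ≤ q)
  have hP0 : 0 < p.toReal := zero_lt_one.trans_le hP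
  have hQ0 : 0 < q.toReal := zero_lt_one.trans_le hQ
  obtain ⟨w, B, hwB, hwγ⟩ := exists_weights hlamlow hlam hΓ hV.γ_nonneg hr
  have hB : 0 ≤ B := (hwB 0).1.trans (hwB 0).2
  set 𝒜 := lpProductSet p A
  set μ : ℕ → ℝ := fun i => 1 + w i / lam i with hμdef
  set μup : ℝ := 1 + B / lamlow with hμup
  have hμup0 : 0 < μup := by positivity
  have hμ : ∀ i, 1 ≤ μ i ∧ μ i ≤ μup := fun i =>
    ⟨le_add_of_nonneg_right (div_nonneg (hwB i).1 (hV.lam_pos i).le),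
      add_le_add_right (div_le_div₀ hB (hwB i).2 hlamlow (hlam i)) 1⟩
  set κ : ℝ := lamlow / μup with hκdef
  have hκ : 0 < κ := div_pos hlamlow hμup0
  have hcoer : ∀ i x, αlow * Metric.infDist x (A i) ^ p.toReal ≤ V i x ∧
      V i x ≤ αup * Metric.infDist x (A i) ^ p.toReal := fun i x => by
    have h0 : 0 ≤ Metric.infDist x (A i) ^ p.toReal := Real.rpow_nonneg Metric.infDist_nonneg _
    exact ⟨(mul_le_mul_of_nonneg_right (hα i).1 h0).trans (hV.coercive i x).1,
      (hV.coercive i x).2.trans (mul_le_mul_of_nonneg_right (hα i).2.2 h0)⟩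
  have hbounds := weightedSum_bounds hP0 hV.isClosed hA hαlow.le hcoer zero_le_one hμ
  set W : lp E p → ℝ := fun x => ∑' i, μ i * V i (x i) with hWdef
  have hWc : Continuous W := continuous_weightedSum hP0 hV.isClosed hA hV.continuous hV.nonneg
    (fun i x => (hcoer i x).2) fun i => ⟨zero_le_one.trans (hμ i).1, (hμ i).2⟩
  have hint : ∀ (x0 : lp E p) (u : ℝ → lp F q), EssBounded u → ∀ T ξ, S.IsSolution x0 u T ξ →
      ∀ s t, 0 ≤ s → s ≤ t → t ∈ timeInterval T →
      W (ξ t) + κ * ∫ r in Icc s t, W (ξ r) ≤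
        W (ξ s) + μup * γup * essSupNorm u ^ q.toReal * (t - s) :=
    fun x0 u hu T ξ hξ s t hs hst ht => hV.weightedSum_integral_le hP0 hQ0 hu hξ hwB hwγ hκ.le
      (fun i => (hμ i).2) (fun i => (div_mul_cancel₀ lamlow hμup0.ne').trans_le (hlam i)) hγu
      (fun x => (hbounds x).1) hWc hs hst ht
  have hdecay : S.OrbitalDecay q 𝒜 W κ (fun r => μup * γup * r ^ q.toReal) := by
    intro x _ u hu T ξ hξ
    refine diniUpperRight_le_of_eventually fun r hr => ?_
    obtain ⟨b, hb0, hbT⟩ := EReal.lt_iff_exists_real_btwn.1 hξ.pos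
    rw [EReal.coe_pos] at hb0
    have hb : b ∈ timeInterval T := ⟨hb0.le, hbT⟩
    rw [← hξ.apply_zero] at hr
    have h1 := eventually_sub_lt_of_integral_le (f := fun t => W (ξ t)) hb0 hκ
      (hWc.comp_continuousOn (hξ.continuousOn.mono
        (Ico_subset_Icc_self.trans (Icc_subset_timeInterval le_rfl hb))))
      (fun t ht => hint x u hu T ξ hξ 0 t le_rfl ht.1.le
        (mem_timeInterval_of_le ht.1.le ht.2.le hb)) hr
    simpa only [sub_zero] using h1
  have hgain : IsClassKInf fun r => μup * γup * r ^ q.toReal :=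
    isClassKInf_mul_rpow (by positivity) hQ0
  have hest : S.HasExpEstimate q 𝒜 ((μup * αup / αlow) ^ p.toReal⁻¹) (κ / p.toReal)
      (fun r => (μup * γup / (κ * αlow) * r ^ q.toReal) ^ p.toReal⁻¹) := by
    intro x0 u hu T ξ hξ t ht
    have hn : 0 ≤ essSupNorm u := ENNReal.toReal_nonneg
    have h1 := le_exp_of_integral_le (f := fun t => W (ξ t)) (b := t) hκ
      (by positivity : 0 ≤ μup * γup * essSupNorm u ^ q.toReal)
      (hWc.comp_continuousOn (hξ.continuousOn.mono (Icc_subset_timeInterval le_rfl ht)))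
      (fun r s hr hrs hst => hint x0 u hu T ξ hξ r s hr hrs
        (mem_timeInterval_of_le (hr.trans hrs) hst ht)) ht.1
    simp only [hξ.apply_zero] at h1
    refine le_of_rpow_le_exp hP Metric.infDist_nonneg Metric.infDist_nonneg (by positivity)
      (by positivity) ?_
    have h2 := (hbounds (ξ t)).2.1
    have h3 := mul_le_mul_of_nonneg_right (hbounds x0).2.2 (Real.exp_nonneg (-κ * t))
    have h4 : αlow * Metric.infDist (ξ t) 𝒜 ^ p.toReal ≤
        μup * αup * Metric.infDist x0 𝒜 ^ p.toReal * Real.exp (-κ * t) +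
          μup * γup * essSupNorm u ^ q.toReal / κ := by
      rw [one_mul] at h2
      exact h2.trans (h1.trans (add_le_add_left h3 _))
    refine (mul_le_mul_iff_right₀ hαlow).1 (h4.trans_eq ?_)
    field_simp
  have hM0 : 0 < (μup * αup / αlow) ^ p.toReal⁻¹ := by positivity
  have ha0 : 0 < κ / p.toReal := by positivity
  have hclassK : IsClassK fun r => (μup * γup / (κ * αlow) * r ^ q.toReal) ^ p.toReal⁻¹ :=
    (isClassKInf_mul_rpow (by positivity) hQ0).toIsClassK.rpow (inv_pos.2 hP0)
  have hclosed : IsClosed 𝒜 := isClosed_lpProductSet hV.isClosed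
  refine ⟨⟨μ, 1, μup, one_pos, hμup0, hμ, fun x => (hbounds x).1,
    ⟨hA, hclosed, fun x => tsum_nonneg fun i => mul_nonneg (zero_le_one.trans (hμ i).1)
      (hV.nonneg i _), hWc.continuousOn, 1 * αlow, μup * αup, p.toReal, κ, _, by positivity,
      by positivity, hP0, hκ, hgain, fun x => (hbounds x).2, hdecay⟩,
    hWc.continuousOn, ⟨κ, hκ, hdecay⟩, fun x => (hbounds x).2⟩,
    ⟨_, _, _, hM0, ha0, hclassK, hest⟩, fun hcont => ⟨hA, hclosed,
      hest.forwardComplete hwp hM0.le ha0.le hcont, _, _, _, hM0, ha0, hclassK, hest⟩⟩
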